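/- Conventions. All groups are abelian and written additively. An inverse sequence $(A_i,\phi_i)_{i\in\mathbb N}$ consists of groups $A_i$ whose domains are subsets of $\mathbb N$, regarded as discrete groups, and surjective homomorphisms $\phi_i : A_i \to A_{i-1}$ for $i>0$. Its inverse limit $\varprojlim (A_i,\phi_i)$ is the subgroup $\{g\in\prod_i A_i : \phi_i(g(i)) = g(i-1) \text{ for all } i>0\}$ of the topological group $\prod_i A_i$. The sequence is a computable t.d.l.c. presentation of a topological abelian group $G$ if (i) uniformly in $i$, the domain of $A_i$ is a computable set, the operations $+$ and $-$ of $A_i$ are computable, and (for $i>0$) $\phi_i$ is computable; (ii) for every $i>0$ the kernel of $\phi_i$ is finite, and from $i$ one can compute a strong index of $\ker\phi_i\subseteq A_i$, that is, the number $\sum_{n\in \ker\phi_i} 2^n$; (iii) $G$ is topologically isomorphic to $\varprojlim (A_i,\phi_i)$. A set $C$ of elements of an abelian group is linearly independent if, for all distinct $c_1,\dots,c_k\in C$ and all $n_1,\dots,n_k\in\mathbb Z$, $n_1c_1+\dots+n_kc_k=0$ implies $n_1=\dots=n_k=0$; it is maximal if no proper superset is linearly independent. Proposition. Suppose $(A_i,\phi_i)$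 is a computable t.d.l.c. presentation of a topological abelian group $G$. Then $G$ has a computable t.d.l.c. presentation $(B_i,\psi_i)$ and sets $C_i\subseteq B_i$ such that each $C_i$ is a maximal linearly independent subset of $B_i$, and $C_i$ is computable uniformly in $i$ (that is, $\{(i,x): x\in C_i\}$ is a computable set). If moreover each $A_i$ has domain $\mathbb N$, then each $B_i$ can be chosen with domain $\mathbb N$. -/

import Mathlib

/-- The strong (canonical) index `∑_{n ∈ F} 2 ^ n` of a finite set `F` of natural numbers. -/
def strongIndex (F : Finset ℕ) : ℕ := ∑ n ∈ F, 2 ^ n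

/-- An inverse sequence `A 0 ← A 1 ← A 2 ← ⋯` of (discrete, additively written) abelian groups and
epimorphisms, the domain of each group being a set of natural numbers.
The map `map i : A (i + 1) → A i` is the one usually written `φ_{i+1}`. -/
structure InverseSequence where
  /-- the domain of the `i`-th group -/
  dom : ℕ → Set ℕ
  /-- the group structure on the `i`-th domain -/
  grp : ∀ i, AddCommGroup (dom i)
  /-- the projections -/
  map : ∀ i, dom (i + 1) →+ dom i
  map_surjective : ∀ i, Function.Surjective (map i)

namespace InverseSequence

attribute [instance] InverseSequence.grp

/-- The inverse limit, a subgroup of the product `∏ i, A i`. Each `A i` carries the topology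
induced from `ℕ`, that is, the discrete one, the product carries the product topology, and the
inverse limit the subspace topology. -/
def invLimit (A : InverseSequence) : AddSubgroup (∀ i, A.dom i) where
  carrier := {g | ∀ i, A.map i (g (i + 1)) = g i}
  add_mem' := by
    intro g h hg hh i
    have h1 : A.map i (g (i + 1)) = g i := hg i
    have h2 : A.map i (h (i + 1)) = h i := hh i
    simp [h1, h2]
  zero_mem' := by
    intro i
    simp
  neg_mem' := by
    intro g hg i
    have h1 : A.map i (g (i + 1)) = g i := hg i
    simp [h1]

/-- The groups `A i` are computable, uniformly in `i` (computable domain, computable operations),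
and so are the projections. -/
structure IsComputable (A : InverseSequence) : Prop where
  dom : ComputablePred fun p : ℕ × ℕ => p.2 ∈ A.dom p.1
  add : ∃ f : ℕ × ℕ × ℕ → ℕ, Computable f ∧
    ∀ (i : ℕ) (x y : A.dom i), f (i, (x : ℕ), (y : ℕ)) = ((x + y : A.dom i) : ℕ)
  neg : ∃ f : ℕ × ℕ → ℕ, Computable f ∧
    ∀ (i : ℕ) (x : A.dom i), f (i, (x : ℕ)) = ((-x : A.dom i) : ℕ)
  map : ∃ f : ℕ × ℕ → ℕ, Computable f ∧
    ∀ (i : ℕ) (x : A.dom (i + 1)), f (i, (x : ℕ)) = (A.map i x : ℕ)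

/-- The kernels of the projections are finite, and from `i` one can compute a strong index of the
kernel of `map i`, as a set of natural numbers. -/
def HasComputableKernels (A : InverseSequence) : Prop :=
  ∃ K : ℕ → Finset ℕ, (Computable fun i => strongIndex (K i)) ∧
    ∀ i, (K i : Set ℕ) = Subtype.val '' {x : A.dom (i + 1) | A.map i x = 0}

/-- `A` is a computable t.d.l.c. presentation of the topological abelian group `G`: the groups and
projections are uniformly computable, the kernels are finite and uniformly given by strong indices,
and `G` is topologically isomorphic to the inverse limit. -/
structure IsComputableTDLCPresentation (A : InverseSequence)
    (G : Type*) [AddCommGroup G] [TopologicalSpace G] : Prop where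
  computable : A.IsComputable
  kernels : A.HasComputableKernels
  iso : Nonempty (G ≃ₜ+ A.invLimit)

/-- Each `C i` is a maximal linearly independent (over `ℤ`) subset of `A i`, and the sets `C i`
are computable uniformly in `i`. -/
structure IsComputableMaximalLinIndep (A : InverseSequence) (C : ∀ i, Set (A.dom i)) : Prop where
  maximal : ∀ i, Maximal (fun s : Set (A.dom i) => LinearIndepOn ℤ id s) (C i)
  computable : ComputablePred fun p : ℕ × ℕ => p.2 ∈ (Subtype.val '' C p.1 : Set ℕ)

end InverseSequence

/-! The kernel of `A i → A 0` is torsion, being built from finitely many finite kernels. Hence a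
family in `A i` that projects to a maximal independent family of `A 0` is itself maximal
independent, and the problem is to choose one in `A 0` whose lifts can be recognized. If `A 0` has
finite rank, finitely many elements are fixed and lifted computably, and `B = A` works.

In infinite rank, consider the greedy basis: the elements that do not depend on those with smaller
numbers. Dependence has a witness that can be searched for, so the `k`-th basis element is only the
limit of computable guesses, which approach it from below and change finitely often. Let `d t k` be
the guess adopted at stage `t`, or `0` if the guess is kept, and put `f k = ∑ t ! • d t k`. The
final guess has positive total weight and all other guesses have smaller numbers, so `f` is
triangular over the greedy basis (`exists_leading_term`), hence maximal independent.

The family `f` need not be computable in `A`, but `f k = P s k + s ! • R s k` with a computable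
partial sum `P` and a tail `R`. An element `x` of `A i` is coded by a stage `s`, integers `w k` with
`s ! • proj x = ∑ w k • f k`, and the element `a = x - ∑ w k • R s k`, where `R` is lifted to `A i`.
Cancelling tails, the condition reads `s ! • proj a = ∑ w k • P s k`, which is decidable
(`valid_iff`). By independence `s` and `x` determine `w`, so codes at a common stage are compared
componentwise (`value_eq_iff`), and a code can be moved to the next stage (`value_step`). Every `x`
has a code, because a nonzero multiple of `proj x` lies in the span of `f` and every nonzero integer
divides some `s !` (`val_surjective`). Decidable equality of codes gives bijections of `ℕ` with the
groups, along which `B` is transported; in `B` the lifts of `f` are found by bounded search. -/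

/-! ### Computable predicates and functions -/

namespace ComputablePred

variable {α β : Type*} [Primcodable α] [Primcodable β]

theorem of_decide {p : α → Prop} (f : α → Bool) (hf : Computable f)
    (h : ∀ a, f a = true ↔ p a) : ComputablePred p :=
  ComputablePred.computable_iff.2 ⟨f, hf, by ext a; simp [h]⟩

theorem exists_bool {p : α → Prop} (hp : ComputablePred p) :
    ∃ f : α → Bool, Computable f ∧ ∀ a, f a = true ↔ p a := by
  obtain ⟨f, hf, h⟩ := ComputablePred.computable_iff.1 hp
  exact ⟨f, hf, fun a => by simp [h]⟩

theorem comp {p : β → Prop} (hp : ComputablePred p) {f : α → β} (hf : Computable f) :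
    ComputablePred fun a => p (f a) := by
  obtain ⟨g, hg, h⟩ := hp.exists_bool
  exact of_decide _ (hg.comp hf) fun a => h _

theorem and {p q : α → Prop} (hp : ComputablePred p) (hq : ComputablePred q) :
    ComputablePred fun a => p a ∧ q a := by
  obtain ⟨f, hf, h⟩ := hp.exists_bool
  obtain ⟨g, hg, h'⟩ := hq.exists_bool
  exact of_decide _ (Primrec.and.to_comp.comp hf hg) fun a => by simp [h, h']

theorem or {p q : α → Prop} (hp : ComputablePred p) (hq : ComputablePred q) :
    ComputablePred fun a => p a ∨ q a := by
  obtain ⟨f, hf, h⟩ := hp.exists_bool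
  obtain ⟨g, hg, h'⟩ := hq.exists_bool
  exact of_decide _ (Primrec.or.to_comp.comp hf hg) fun a => by simp [h, h']

theorem eq {f g : α → β} (hf : Computable f) (hg : Computable g) :
    ComputablePred fun a => f a = g a := by
  classical
  exact (Primrec.eq (α := β)).computablePred.comp (hf.pair hg)

theorem exists_lt {p : α × ℕ → Prop} (hp : ComputablePred p) {f : α → ℕ} (hf : Computable f) :
    ComputablePred fun a => ∃ k < f a, p (a, k) := by
  obtain ⟨g, hg, h⟩ := hp.exists_bool
  have : Computable fun a => (Nat.rec false (fun k b => b || g (a, k)) (f a) : Bool) :=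
    Computable.nat_rec (h := fun a q => q.2 || g (a, q.1)) hf (Computable.const false)
      (Primrec.or.to_comp.comp (Computable.snd.comp Computable.snd)
        (hg.comp (Computable.fst.pair (Computable.fst.comp Computable.snd)))).to₂
  refine of_decide _ this fun a => ?_
  induction f a with
  | zero => simp
  | succ n ih =>
    simp only [Bool.or_eq_true, ih, h]
    constructor
    · rintro (⟨k, hk, h⟩ | h)
      exacts [⟨k, by omega, h⟩, ⟨n, by omega, h⟩]
    · rintro ⟨k, hk, h⟩
      rcases Nat.lt_succ_iff_lt_or_eq.1 hk with hk | rfl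
      exacts [.inl ⟨k, hk, h⟩, .inr h]

theorem forall_lt {p : α × ℕ → Prop} (hp : ComputablePred p) {f : α → ℕ} (hf : Computable f) :
    ComputablePred fun a => ∀ k < f a, p (a, k) :=
  ((hp.not.exists_lt hf).not).of_eq fun a => by push Not; rfl

end ComputablePred

namespace Computable

variable {α β : Type*} [Primcodable α] [Primcodable β]

theorem ite_pred {p : α → Prop} [DecidablePred p] (hp : ComputablePred p) {f g : α → β}
    (hf : Computable f) (hg : Computable g) : Computable fun a => if p a then f a else g a :=
  (Computable.cond hp.decide hf hg).of_eq fun a => by by_cases h : p a <;> simp [h]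

theorem of_isLeast {p : α × ℕ → Prop} (hp : ComputablePred p) {f : α → ℕ}
    (h : ∀ a, IsLeast {n | p (a, n)} (f a)) : Computable f := by
  obtain ⟨g, hg, hgp⟩ := hp.exists_bool
  refine (Partrec.rfind (p := fun a n => Part.some (g (a, n))) hg.partrec).of_eq_tot fun a => ?_
  refine Nat.mem_rfind.2 ⟨by simpa [hgp] using (h a).1, fun {m} hm => ?_⟩
  have : ¬ p (a, m) := fun hp => absurd ((h a).2 hp) (by omega)
  simpa [← hgp] using this

theorem of_graph {p : α × ℕ → Prop} (hp : ComputablePred p) {f : α → ℕ}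
    (h : ∀ a n, p (a, n) ↔ n = f a) : Computable f :=
  of_isLeast hp fun _ => ⟨(h _ _).2 rfl, fun _ hn => ((h _ _).1 hn).ge⟩

theorem sum_range {f : α × ℕ → ℕ} (hf : Computable f) {n : α → ℕ} (hn : Computable n) :
    Computable fun a => ∑ k ∈ Finset.range (n a), f (a, k) := by
  have : Computable fun a => (Nat.rec 0 (fun k b => b + f (a, k)) (n a) : ℕ) :=
    Computable.nat_rec (h := fun a q => q.2 + f (a, q.1)) hn (Computable.const 0)
      (Primrec.nat_add.to_comp.comp (Computable.snd.comp Computable.snd)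
        (hf.comp (Computable.fst.pair (Computable.fst.comp Computable.snd)))).to₂
  refine this.of_eq fun a => ?_
  induction n a with
  | zero => simp
  | succ n ih => simp only [ih, Finset.sum_range_succ]

/-- The graph is decidable: the value is the only element of the set with exactly `k a` smaller
ones. -/
theorem nth {p : α × ℕ → Prop} (hp : ComputablePred p) (hinf : ∀ a, {n | p (a, n)}.Infinite)
    {k : α → ℕ} (hk : Computable k) : Computable fun a => Nat.nth (fun n => p (a, n)) (k a) := by
  classical
  have hcount : Computable fun q : α × ℕ => Nat.count (fun n => p (q.1, n)) q.2 := by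
    refine (sum_range (f := fun r : (α × ℕ) × ℕ => if p (r.1.1, r.2) then 1 else 0)
      (ite_pred (hp.comp ((fst.comp fst).pair snd)) (const 1) (const 0)) snd).of_eq fun q => ?_
    rw [Nat.count_eq_card_filter_range, Finset.card_filter]
  refine of_graph (hp.and (ComputablePred.eq hcount (hk.comp fst))) ?_
  intro a n
  constructor
  · rintro ⟨h, h'⟩
    rw [← h', Nat.nth_count (p := fun n => p (a, n)) h]
  · rintro rfl
    exact ⟨Nat.nth_mem_of_infinite (hinf a) _, Nat.count_nth_of_infinite (hinf a) _⟩

theorem two_pow {f : α → ℕ} (hf : Computable f) : Computable fun a => 2 ^ f a := by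
  have : Computable fun a => (Nat.rec 1 (fun _ b => b * 2) (f a) : ℕ) :=
    Computable.nat_rec (h := fun _ q => q.2 * 2) hf (Computable.const 1)
      (Primrec.nat_mul.to_comp.comp (Computable.snd.comp Computable.snd) (const 2)).to₂
  refine this.of_eq fun a => ?_
  induction f a with
  | zero => simp
  | succ n ih => simp only [ih, pow_succ]

end Computable

/-! ### Codes for integer coefficient vectors -/

/-- Codes for finitely supported integer vectors, as differences of two lists of naturals. -/
abbrev CoeffWord := List ℕ × List ℕ

namespace CoeffWord

noncomputable def vec (w : CoeffWord) : ℕ →₀ ℤ :=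
  Finsupp.onFinset (Finset.range (w.1.length + w.2.length))
    (fun k => (w.1.getD k 0 : ℤ) - (w.2.getD k 0 : ℤ)) fun k hk => by
      by_contra h
      simp only [Finset.mem_range, not_lt] at h
      rw [List.getD_eq_default _ _ (by omega), List.getD_eq_default _ _ (by omega)] at hk
      simp at hk

theorem vec_apply (w : CoeffWord) (k : ℕ) :
    w.vec k = (w.1.getD k 0 : ℤ) - (w.2.getD k 0 : ℤ) := rfl

/-- Pointwise sum of two lists, each extended by zeros. -/
def addList (l m : List ℕ) : List ℕ :=
  (List.range (l.length + m.length)).map fun k => l.getD k 0 + m.getD k 0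

theorem getD_addList (l m : List ℕ) (k : ℕ) :
    (addList l m).getD k 0 = l.getD k 0 + m.getD k 0 := by
  by_cases h : k < l.length + m.length
  · simp [addList, List.getD_eq_getElem?_getD, h]
  · rw [List.getD_eq_default _ _ (by simp [addList]; omega), List.getD_eq_default _ _ (by omega),
      List.getD_eq_default _ _ (by omega)]

def add (w v : CoeffWord) : CoeffWord := (addList w.1 v.1, addList w.2 v.2)

def neg (w : CoeffWord) : CoeffWord := (w.2, w.1)

def scale (c : ℕ) (w : CoeffWord) : CoeffWord := (w.1.map (c * ·), w.2.map (c * ·))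

def single (k : ℕ) : CoeffWord := ((List.range (k + 1)).map fun j => if j = k then 1 else 0, [])

@[simp] theorem vec_add (w v : CoeffWord) : (w.add v).vec = w.vec + v.vec := by
  ext k
  simp only [vec_apply, add, getD_addList, Finsupp.add_apply]
  push_cast
  ring

@[simp] theorem vec_neg (w : CoeffWord) : w.neg.vec = -w.vec := by
  ext k
  simp [vec_apply, neg]

@[simp] theorem vec_scale (c : ℕ) (w : CoeffWord) : (w.scale c).vec = c • w.vec := by
  have key : ∀ (l : List ℕ) (k : ℕ), (l.map (c * ·)).getD k 0 = c * l.getD k 0 := fun l k => by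
    have := List.getD_map (l := l) (d := 0) (n := k) (c * ·)
    simpa using this
  ext k
  simp only [vec_apply, scale, key, Finsupp.smul_apply]
  push_cast
  simp [mul_sub]

@[simp] theorem vec_nil : vec ([], []) = 0 := by
  ext k
  simp [vec_apply]

@[simp] theorem vec_single (k : ℕ) : (single k).vec = Finsupp.single k 1 := by
  ext j
  by_cases h : j < k + 1
  · simp [vec_apply, single, List.getD_eq_getElem?_getD, h, Finsupp.single_apply, eq_comm]
  · rw [vec_apply, List.getD_eq_default _ _ (by simp [single]; omega), Finsupp.single_apply,
      if_neg (by omega)]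
    simp [single]

theorem vec_surjective : Function.Surjective vec := by
  intro z
  obtain ⟨N, hN⟩ : ∃ N, ∀ k, N ≤ k → z k = 0 :=
    ⟨z.support.sup id + 1, fun k hk => by
      by_contra h
      have := Finset.le_sup (f := id) (Finsupp.mem_support_iff.2 h)
      simp only [id] at this
      omega⟩
  have key : ∀ (f : ℕ → ℕ) (k : ℕ), (∀ k, N ≤ k → f k = 0) →
      ((List.range N).map f).getD k 0 = f k := fun f k hf => by
    by_cases h : k < N
    · simp [List.getD_eq_getElem?_getD, h]
    · rw [List.getD_eq_default _ _ (by simpa using h), hf k (by omega)]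
  refine ⟨((List.range N).map fun k => (z k).toNat, (List.range N).map fun k => (-z k).toNat), ?_⟩
  ext k
  rw [vec_apply, key _ _ fun k hk => by simp [hN k hk], key _ _ fun k hk => by simp [hN k hk]]
  omega

theorem linearCombination_vec {M : Type*} [AddCommGroup M] (u : ℕ → M) (w : CoeffWord) :
    Finsupp.linearCombination ℤ u w.vec =
      (∑ k ∈ Finset.range (w.1.length + w.2.length), w.1.getD k 0 • u k) +
        -(∑ k ∈ Finset.range (w.1.length + w.2.length), w.2.getD k 0 • u k) := by
  rw [Finsupp.linearCombination_apply, vec, Finsupp.onFinset_sum _ (by simp), ← sub_eq_add_neg,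
    ← Finset.sum_sub_distrib]
  simp [sub_smul]

theorem computable_getD : Computable fun p : List ℕ × ℕ => p.1.getD p.2 0 :=
  (Primrec.list_getD 0).to_comp

theorem primrec_addList : Primrec fun p : List ℕ × List ℕ => addList p.1 p.2 :=
  Primrec.list_map (Primrec.list_range.comp (Primrec.nat_add.comp
    (Primrec.list_length.comp Primrec.fst) (Primrec.list_length.comp Primrec.snd)))
    (Primrec.nat_add.comp
      ((Primrec.list_getD 0).comp (Primrec.fst.comp Primrec.fst) Primrec.snd)
      ((Primrec.list_getD 0).comp (Primrec.snd.comp Primrec.fst) Primrec.snd)).to₂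

theorem computable_add : Computable fun p : CoeffWord × CoeffWord => p.1.add p.2 :=
  Primrec.to_comp <| Primrec.pair
    (primrec_addList.comp ((Primrec.fst.comp Primrec.fst).pair (Primrec.fst.comp Primrec.snd)))
    (primrec_addList.comp ((Primrec.snd.comp Primrec.fst).pair (Primrec.snd.comp Primrec.snd)))

theorem computable_neg : Computable neg := Computable.snd.pair Computable.fst

theorem computable_scale : Computable fun p : ℕ × CoeffWord => p.2.scale p.1 := by
  have key : Primrec fun p : ℕ × List ℕ => p.2.map (p.1 * ·) :=
    Primrec.list_map Primrec.snd
      (Primrec.nat_mul.comp (Primrec.fst.comp Primrec.fst) Primrec.snd).to₂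
  exact Primrec.to_comp <| Primrec.pair
    (key.comp (Primrec.fst.pair (Primrec.fst.comp Primrec.snd)))
    (key.comp (Primrec.fst.pair (Primrec.snd.comp Primrec.snd)))

theorem computable_single : Computable single :=
  Primrec.to_comp <| Primrec.pair
    (Primrec.list_map (Primrec.list_range.comp Primrec.succ)
      (Primrec.ite (Primrec.eq.comp Primrec.snd Primrec.fst) (Primrec.const 1)
        (Primrec.const 0)).to₂) (Primrec.const [])

theorem computablePred_vec_eq :
    ComputablePred fun p : CoeffWord × CoeffWord => p.1.vec = p.2.vec := by
  have hl : Computable fun p : CoeffWord × CoeffWord => (p.1.add p.2).1.length +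
      (p.1.add p.2).2.length :=
    Primrec.nat_add.to_comp.comp
      (Computable.list_length.comp (Computable.fst.comp computable_add))
      (Computable.list_length.comp (Computable.snd.comp computable_add))
  have hc : ∀ {f : (CoeffWord × CoeffWord) × ℕ → List ℕ}, Computable f →
      Computable fun q => (f q).getD q.2 0 := fun hf =>
    computable_getD.comp (hf.pair Computable.snd)
  refine ((ComputablePred.eq
    (Primrec.nat_add.to_comp.comp
      (hc (Computable.fst.comp (Computable.fst.comp Computable.fst)))
      (hc (Computable.snd.comp (Computable.snd.comp Computable.fst))))
    (Primrec.nat_add.to_comp.comp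
      (hc (Computable.fst.comp (Computable.snd.comp Computable.fst)))
      (hc (Computable.snd.comp (Computable.fst.comp Computable.fst))))).forall_lt hl).of_eq ?_
  rintro ⟨w, v⟩
  constructor
  · intro h
    change w.vec = v.vec
    ext k
    by_cases hk : k < (w.add v).1.length + (w.add v).2.length
    · have := h k hk
      simp only [vec_apply] at this ⊢
      omega
    · simp only [add, addList, List.length_map, List.length_range] at hk
      rw [vec_apply, vec_apply, List.getD_eq_default _ _ (by omega),
        List.getD_eq_default _ _ (by omega), List.getD_eq_default _ _ (by omega),
        List.getD_eq_default _ _ (by omega)]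
  · intro h k _
    have := DFunLike.congr_fun h k
    simp only [vec_apply] at this ⊢
    omega

end CoeffWord

/-! ### Projections to the first group, lifts, and their computability -/

namespace InverseSequence

/-- The composite projection onto the first group of the sequence. -/
def proj (A : InverseSequence) : ∀ i, A.dom i →+ A.dom 0
  | 0 => AddMonoidHom.id _
  | i + 1 => (A.proj i).comp (A.map i)

theorem proj_succ_apply (A : InverseSequence) (i : ℕ) (x : A.dom (i + 1)) :
    A.proj (i + 1) x = A.proj i (A.map i x) := rfl

theorem proj_surjective (A : InverseSequence) : ∀ i, Function.Surjective (A.proj i)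
  | 0 => Function.surjective_id
  | i + 1 => (A.proj_surjective i).comp (A.map_surjective i)

open Classical in
/-- The element of `A i` with number `n`, if there is one. -/
noncomputable def elem (A : InverseSequence) (i n : ℕ) : A.dom i :=
  if h : n ∈ A.dom i then ⟨n, h⟩ else 0

@[simp] theorem elem_coe (A : InverseSequence) (i : ℕ) (x : A.dom i) : A.elem i x = x := by
  simp [elem]

theorem exists_preimage_nat (A : InverseSequence) (i : ℕ) (y : A.dom i) :
    ∃ n, ∃ h : n ∈ A.dom (i + 1), A.map i ⟨n, h⟩ = y := by
  obtain ⟨⟨n, h⟩, hx⟩ := A.map_surjective i y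
  exact ⟨n, h, hx⟩

open Classical in
/-- The preimage with the least number, except that zero is lifted to zero. -/
noncomputable def liftStep (A : InverseSequence) (i : ℕ) (y : A.dom i) : A.dom (i + 1) :=
  if y = 0 then 0 else
    ⟨Nat.find (A.exists_preimage_nat i y), (Nat.find_spec (A.exists_preimage_nat i y)).1⟩

theorem map_liftStep (A : InverseSequence) (i : ℕ) (y : A.dom i) :
    A.map i (A.liftStep i y) = y := by
  classical
  unfold liftStep
  split_ifs with h
  · simp [h]
  · exact (Nat.find_spec (A.exists_preimage_nat i y)).2

/-- A compatible choice of preimages of the elements of `A 0`. -/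
noncomputable def lift (A : InverseSequence) (x : A.dom 0) : ∀ i, A.dom i
  | 0 => x
  | i + 1 => A.liftStep i (A.lift x i)

@[simp] theorem map_lift (A : InverseSequence) (x : A.dom 0) (i : ℕ) :
    A.map i (A.lift x (i + 1)) = A.lift x i := A.map_liftStep i _

-- This is why `liftStep` treats zero separately: vanishing increments must stay zero at every
-- level, whereas the least preimage of zero may be nonzero.
@[simp] theorem lift_zero (A : InverseSequence) : ∀ i, A.lift 0 i = 0
  | 0 => rfl
  | i + 1 => by
    rw [lift, lift_zero A i]
    simp [liftStep]

@[simp] theorem proj_lift (A : InverseSequence) (x : A.dom 0) : ∀ i, A.proj i (A.lift x i) = x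
  | 0 => rfl
  | i + 1 => by rw [proj_succ_apply, map_lift, proj_lift A x i]

namespace IsComputable

variable {A : InverseSequence} (hA : A.IsComputable) {α : Type*} [Primcodable α]
include hA

theorem mem_dom {i : α → ℕ} (hi : Computable i) {n : α → ℕ} (hn : Computable n) :
    ComputablePred fun a => n a ∈ A.dom (i a) :=
  hA.dom.comp (hi.pair hn)

theorem computable_add {i : α → ℕ} (hi : Computable i) {g h : ∀ a, A.dom (i a)}
    (hg : Computable fun a => (g a : ℕ)) (hh : Computable fun a => (h a : ℕ)) :
    Computable fun a => ((g a + h a : A.dom (i a)) : ℕ) := by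
  obtain ⟨f, hf, hfs⟩ := hA.add
  exact (hf.comp (hi.pair (hg.pair hh))).of_eq fun a => hfs _ _ _

theorem computable_neg {i : α → ℕ} (hi : Computable i) {g : ∀ a, A.dom (i a)}
    (hg : Computable fun a => (g a : ℕ)) : Computable fun a => ((-g a : A.dom (i a)) : ℕ) := by
  obtain ⟨f, hf, hfs⟩ := hA.neg
  exact (hf.comp (hi.pair hg)).of_eq fun a => hfs _ _

theorem computable_map {i : α → ℕ} (hi : Computable i) {g : ∀ a, A.dom (i a + 1)}
    (hg : Computable fun a => (g a : ℕ)) : Computable fun a => (A.map (i a) (g a) : ℕ) := by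
  obtain ⟨f, hf, hfs⟩ := hA.map
  exact (hf.comp (hi.pair hg)).of_eq fun a => hfs _ _

theorem computable_zero {i : α → ℕ} (hi : Computable i) :
    Computable fun a => ((0 : A.dom (i a)) : ℕ) := by
  classical
  have hex : ∀ i, ∃ n, n ∈ A.dom i := fun i => ⟨_, (0 : A.dom i).2⟩
  let g : ∀ i, A.dom i := fun i => ⟨Nat.find (hex i), Nat.find_spec (hex i)⟩
  have hg : Computable fun i => (g i : ℕ) :=
    Computable.of_isLeast (hA.dom) fun i => Nat.isLeast_find (hex i)
  -- Zero is found as `x + -x`, with `x` the least number in the domain.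
  exact (hA.computable_add hi (hg.comp hi) (hA.computable_neg hi (hg.comp hi))).of_eq
    fun a => by simp

theorem computable_elem {i : α → ℕ} (hi : Computable i) {n : α → ℕ} (hn : Computable n) :
    Computable fun a => (A.elem (i a) (n a) : ℕ) := by
  classical
  refine (Computable.ite_pred (hA.mem_dom hi hn) hn (hA.computable_zero hi)).of_eq fun a => ?_
  unfold elem
  split_ifs <;> simp

theorem computable_sum {i : α → ℕ} (hi : Computable i) {g : ∀ a, ℕ → A.dom (i a)}
    (hg : Computable fun p : α × ℕ => (g p.1 p.2 : ℕ)) {n : α → ℕ} (hn : Computable n) :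
    Computable fun a => ((∑ k ∈ Finset.range (n a), g a k : A.dom (i a)) : ℕ) := by
  have hstep : Computable fun p : α × (ℕ × ℕ) =>
      ((A.elem (i p.1) p.2.2 + g p.1 p.2.1 : A.dom (i p.1)) : ℕ) :=
    hA.computable_add (hi.comp Computable.fst)
      (hA.computable_elem (hi.comp Computable.fst) (Computable.snd.comp Computable.snd))
      (hg.comp (Computable.fst.pair (Computable.fst.comp Computable.snd)))
  refine (Computable.nat_rec (h := fun a q => ((A.elem (i a) q.2 + g a q.1 : A.dom (i a)) : ℕ))
    hn (hA.computable_zero hi) hstep.to₂).of_eq fun a => ?_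
  induction n a with
  | zero => simp
  | succ n ih => simp only [ih, Finset.sum_range_succ, elem_coe]

theorem computable_nsmul {i : α → ℕ} (hi : Computable i) {g : ∀ a, A.dom (i a)}
    (hg : Computable fun a => (g a : ℕ)) {n : α → ℕ} (hn : Computable n) :
    Computable fun a => ((n a • g a : A.dom (i a)) : ℕ) :=
  (hA.computable_sum hi (g := fun a _ => g a) (hg.comp Computable.fst) hn).of_eq
    fun a => by simp

theorem computable_linearCombination {i : α → ℕ} (hi : Computable i) {u : ∀ a, ℕ → A.dom (i a)}
    (hu : Computable fun p : α × ℕ => (u p.1 p.2 : ℕ)) {w : α → CoeffWord} (hw : Computable w) :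
    Computable fun a =>
      ((Finsupp.linearCombination ℤ (u a) (w a).vec : A.dom (i a)) : ℕ) := by
  simp only [CoeffWord.linearCombination_vec]
  have hl := Primrec.nat_add.to_comp.comp (Computable.list_length.comp (Computable.fst.comp hw))
    (Computable.list_length.comp (Computable.snd.comp hw))
  have hc : ∀ {f : α → List ℕ}, Computable f → Computable fun p : α × ℕ => (f p.1).getD p.2 0 :=
    fun hf => CoeffWord.computable_getD.comp ((hf.comp Computable.fst).pair Computable.snd)
  have hi' : Computable fun p : α × ℕ => i p.1 := hi.comp Computable.fst
  exact hA.computable_add hi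
    (hA.computable_sum hi (g := fun a k => (w a).1.getD k 0 • u a k)
      (hA.computable_nsmul hi' hu (hc (Computable.fst.comp hw))) hl)
    (hA.computable_neg hi
      (hA.computable_sum hi (g := fun a k => (w a).2.getD k 0 • u a k)
        (hA.computable_nsmul hi' hu (hc (Computable.snd.comp hw))) hl))

theorem computable_proj {i : α → ℕ} (hi : Computable i) {g : ∀ a, A.dom (i a)}
    (hg : Computable fun a => (g a : ℕ)) : Computable fun a => (A.proj (i a) (g a) : ℕ) := by
  have hidx : Computable fun p : α × (ℕ × ℕ) => i p.1 - p.2.1 - 1 :=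
    Primrec.nat_sub.to_comp.comp (Primrec.nat_sub.to_comp.comp (hi.comp Computable.fst)
      (Computable.fst.comp Computable.snd)) (Computable.const 1)
  have hstep := hA.computable_map hidx (g := fun p => A.elem (i p.1 - p.2.1 - 1 + 1) p.2.2)
    (hA.computable_elem (Computable.succ.comp hidx) (Computable.snd.comp Computable.snd))
  refine (Computable.nat_rec hi hg hstep.to₂).of_eq fun a => ?_
  -- `y` is the image of `g a` after `j` steps down. The truncated subtractions are exact while `m +
  -- j = i a`.
  have key : ∀ j m, m + j = i a → ∃ y : A.dom m, (y : ℕ) = Nat.rec (g a : ℕ)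
      (fun j n => (A.map (i a - j - 1) (A.elem (i a - j - 1 + 1) n) : ℕ)) j ∧
      A.proj m y = A.proj (i a) (g a) := by
    intro j
    induction j with
    | zero => rintro m rfl; exact ⟨g a, rfl, rfl⟩
    | succ j ih =>
      intro m hm
      obtain ⟨y, hy, hy'⟩ := ih (m + 1) (by omega)
      refine ⟨A.map m y, ?_, hy'⟩
      obtain rfl : m = i a - j - 1 := by omega
      simp only [← hy, elem_coe]
  obtain ⟨y, hy, hy'⟩ := key (i a) 0 (by omega)
  exact hy.symm.trans (congrArg Subtype.val hy')

theorem computable_liftStep {i : α → ℕ} (hi : Computable i) {g : ∀ a, A.dom (i a)}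
    (hg : Computable fun a => (g a : ℕ)) : Computable fun a => (A.liftStep (i a) (g a) : ℕ) := by
  classical
  have hi1 : Computable fun p : α × ℕ => i p.1 := hi.comp Computable.fst
  have hi2 : Computable fun p : α × ℕ => i p.1 + 1 := Computable.succ.comp hi1
  have hfind : Computable fun a => Nat.find (A.exists_preimage_nat (i a) (g a)) := by
    refine Computable.of_isLeast ((hA.mem_dom hi2 Computable.snd).and (ComputablePred.eq
      (hA.computable_map hi1 (g := fun p : α × ℕ => A.elem (i p.1 + 1) p.2)
        (hA.computable_elem hi2 Computable.snd)) (hg.comp Computable.fst))) fun a => ?_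
    convert Nat.isLeast_find (A.exists_preimage_nat (i a) (g a)) using 1
    ext n
    refine ⟨fun ⟨h, h'⟩ => ⟨h, Subtype.ext ?_⟩, fun ⟨h, h'⟩ => ⟨h, ?_⟩⟩
    · simpa [elem, show n ∈ A.dom (i a + 1) from h] using h'
    · simp [elem, show n ∈ A.dom (i a + 1) from h, h']
  refine (Computable.ite_pred (ComputablePred.eq hg (hA.computable_zero hi))
    (hA.computable_zero (Computable.succ.comp hi)) hfind).of_eq fun a => ?_
  unfold liftStep
  by_cases h : g a = 0
  · simp [h]
  · rw [if_neg h, if_neg fun h' => h (Subtype.ext h')]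

theorem computable_lift {i : α → ℕ} (hi : Computable i) {g : α → A.dom 0}
    (hg : Computable fun a => (g a : ℕ)) : Computable fun a => (A.lift (g a) (i a) : ℕ) := by
  have hidx : Computable fun p : α × (ℕ × ℕ) => p.2.1 := Computable.fst.comp Computable.snd
  have hstep := hA.computable_liftStep hidx
    (hA.computable_elem hidx (Computable.snd.comp Computable.snd))
  refine (Computable.nat_rec hi hg hstep.to₂).of_eq fun a => ?_
  induction i a with
  | zero => rfl
  | succ n ih => simp only [ih, elem_coe]; rfl

end IsComputable

end InverseSequence

/-! ### Independence and radical closure -/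

/-- The radical closure of a set in an abelian group: the elements with a nonzero multiple in the
subgroup it generates. -/
def radicalSpan {M : Type*} [AddCommGroup M] (S : Set M) : Submodule ℤ M where
  carrier := {x | ∃ m : ℤ, m ≠ 0 ∧ m • x ∈ Submodule.span ℤ S}
  zero_mem' := ⟨1, one_ne_zero, by simp⟩
  add_mem' := by
    rintro x y ⟨m, hm, hx⟩ ⟨n, hn, hy⟩
    refine ⟨m * n, mul_ne_zero hm hn, ?_⟩
    rw [smul_add, mul_comm, mul_smul, mul_comm, mul_smul]
    exact add_mem (Submodule.smul_mem _ _ hx) (Submodule.smul_mem _ _ hy)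
  smul_mem' := by
    rintro c x ⟨m, hm, hx⟩
    exact ⟨m, hm, by rw [smul_comm]; exact Submodule.smul_mem _ _ hx⟩

section radicalSpan

variable {M : Type*} [AddCommGroup M]

theorem mem_radicalSpan {S : Set M} {x : M} :
    x ∈ radicalSpan S ↔ ∃ m : ℤ, m ≠ 0 ∧ m • x ∈ Submodule.span ℤ S := Iff.rfl

theorem span_le_radicalSpan (S : Set M) : Submodule.span ℤ S ≤ radicalSpan S :=
  fun x hx => ⟨1, one_ne_zero, by simpa using hx⟩

theorem subset_radicalSpan (S : Set M) : S ⊆ radicalSpan S :=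
  fun _ hx => span_le_radicalSpan S (Submodule.subset_span hx)

theorem mem_radicalSpan_of_smul_mem {S : Set M} {x : M} {m : ℤ} (hm : m ≠ 0)
    (h : m • x ∈ radicalSpan S) : x ∈ radicalSpan S := by
  obtain ⟨n, hn, hx⟩ := h
  exact ⟨n * m, mul_ne_zero hn hm, by rwa [mul_smul]⟩

theorem radicalSpan_le {S T : Set M} (h : S ⊆ radicalSpan T) : radicalSpan S ≤ radicalSpan T := by
  rintro x ⟨m, hm, hx⟩
  exact mem_radicalSpan_of_smul_mem hm (Submodule.span_le.2 h hx)

theorem radicalSpan_mono {S T : Set M} (h : S ⊆ T) : radicalSpan S ≤ radicalSpan T :=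
  radicalSpan_le (h.trans (subset_radicalSpan T))

theorem linearIndependent_of_notMem_radicalSpan {ι : Type*} [LinearOrder ι] (g : ι → M)
    (h : ∀ k, g k ∉ radicalSpan (g '' Set.Iio k)) : LinearIndependent ℤ g := by
  rw [linearIndependent_iff]
  intro l hl
  by_contra hne
  have hs : l.support.Nonempty := Finsupp.support_nonempty_iff.2 hne
  -- In a relation, the term of largest index has a nonzero multiple in the span of earlier terms.
  set K := l.support.max' hs with hK
  have hKm : K ∈ l.support := l.support.max'_mem hs
  refine h K ⟨l K, Finsupp.mem_support_iff.1 hKm, ?_⟩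
  rw [Finsupp.linearCombination_apply, Finsupp.sum, ← Finset.add_sum_erase _ _ hKm] at hl
  rw [eq_neg_of_add_eq_zero_left hl]
  refine neg_mem (Submodule.sum_mem _ fun j hj => Submodule.smul_mem _ _
    (Submodule.subset_span ⟨j, ?_, rfl⟩))
  exact lt_of_le_of_ne (l.support.le_max' j (Finset.mem_of_mem_erase hj)) (Finset.ne_of_mem_erase hj)

theorem maximal_linearIndepOn_range {ι : Type*} {g : ι → M} (hg : LinearIndependent ℤ g)
    (hgen : ∀ x, x ∈ radicalSpan (Set.range g)) :
    Maximal (fun s : Set M => LinearIndepOn ℤ id s) (Set.range g) := by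
  refine ⟨hg.linearIndepOn_id, fun s hs hgs x hx => ?_⟩
  by_contra hxg
  obtain ⟨m, hm, h⟩ := hgen x
  refine hm (hs.eq_zero_of_smul_mem_span hx m (Submodule.span_mono ?_ h))
  rintro y hy
  exact ⟨y, ⟨hgs hy, fun hyx => hxg (Set.mem_singleton_iff.1 hyx ▸ hy)⟩, rfl⟩

/-- A dependence on `p ∘ g` lifts to one on `g` up to an error in the kernel, which a further
nonzero multiple kills. -/
theorem linearIndependent_radicalSpan_of_hom {N ι : Type*} [AddCommGroup N] (p : N →+ M)
    (hp : ∀ x, p x = 0 → ∃ m : ℤ, m ≠ 0 ∧ m • x = 0) {g : ι → N}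
    (hg : LinearIndependent ℤ (p ∘ g)) (hgen : ∀ x, x ∈ radicalSpan (Set.range (p ∘ g))) :
    LinearIndependent ℤ g ∧ ∀ x, x ∈ radicalSpan (Set.range g) := by
  refine ⟨LinearIndependent.of_comp p.toIntLinearMap hg, fun x => ?_⟩
  obtain ⟨m, hm, h⟩ := hgen (p x)
  have : Submodule.span ℤ (Set.range (p ∘ g)) =
      (Submodule.span ℤ (Set.range g)).map p.toIntLinearMap := by
    rw [Submodule.map_span, Set.range_comp]; rfl
  rw [this] at h
  obtain ⟨y, hy, hyx⟩ := h
  obtain ⟨r, hr, h0⟩ := hp (m • x - y) (by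
    rw [map_sub, map_zsmul, ← hyx]; exact sub_self _)
  refine ⟨r * m, mul_ne_zero hr hm, ?_⟩
  rw [smul_sub, sub_eq_zero, ← mul_smul] at h0
  rw [h0]
  exact Submodule.smul_mem _ _ hy

/-- The indices of the terms of a sequence that do not depend on earlier terms. -/
def greedyIndices (u : ℕ → M) : Set ℕ := {n | u n ∉ radicalSpan (u '' Set.Iio n)}

theorem image_Iio_subset_radicalSpan_greedy (u : ℕ → M) (n : ℕ) :
    u '' Set.Iio n ⊆ radicalSpan (u '' (greedyIndices u ∩ Set.Iio n)) := by
  rintro _ ⟨m, hm, rfl⟩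
  induction m using Nat.strong_induction_on with
  | _ m ih =>
    by_cases h : m ∈ greedyIndices u
    · exact subset_radicalSpan _ ⟨m, ⟨h, hm⟩, rfl⟩
    · refine radicalSpan_le ?_ (not_not.1 h)
      rintro _ ⟨j, hj, rfl⟩
      exact ih j hj (Set.mem_Iio.2 (lt_trans (Set.mem_Iio.1 hj) (Set.mem_Iio.1 hm)))

theorem linearIndependent_greedy (u : ℕ → M) :
    LinearIndependent ℤ fun n : greedyIndices u => u n := by
  refine linearIndependent_of_notMem_radicalSpan _ fun k hk => k.2 (radicalSpan_mono ?_ hk)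
  rintro _ ⟨j, hj, rfl⟩
  exact ⟨j, hj, rfl⟩

theorem mem_radicalSpan_greedy {u : ℕ → M} (hu : Function.Surjective u) (x : M) :
    x ∈ radicalSpan (Set.range fun n : greedyIndices u => u n) := by
  obtain ⟨n, rfl⟩ := hu x
  refine radicalSpan_mono ?_ (image_Iio_subset_radicalSpan_greedy u (n + 1)
    ⟨n, Nat.lt_succ_self n, rfl⟩)
  rintro _ ⟨j, hj, rfl⟩
  exact ⟨⟨j, hj.1⟩, rfl⟩

/-! ### Families triangular over the greedy basis -/

section triangular

variable {u : ℕ → M} {c : ℕ → ℕ} (hc : StrictMono c) (hcr : Set.range c = greedyIndices u)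
  {g : ℕ → M} (hg : ∀ k, ∃ N : ℤ, N ≠ 0 ∧ g k - N • u (c k) ∈ Submodule.span ℤ (u '' Set.Iio (c k)))

include hc hcr hg

/-- The greedy indices below `c k` are the `c l` with `l < k`. A nonzero multiple of `u (c l)` is `g
l` minus a combination of terms below `c l`, which are covered by induction. -/
theorem image_Iio_subset_radicalSpan_triangular (k : ℕ) :
    u '' Set.Iio (c k) ⊆ radicalSpan (g '' Set.Iio k) := by
  induction k using Nat.strong_induction_on with
  | _ k ih =>
    refine (image_Iio_subset_radicalSpan_greedy u (c k)).trans (radicalSpan_le ?_)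
    rintro _ ⟨n, ⟨hn, hnk⟩, rfl⟩
    rw [← hcr] at hn
    obtain ⟨l, rfl⟩ := hn
    have hl : l < k := hc.lt_iff_lt.1 hnk
    obtain ⟨N, hN, h⟩ := hg l
    refine mem_radicalSpan_of_smul_mem hN ?_
    have h1 : g l ∈ radicalSpan (g '' Set.Iio k) := subset_radicalSpan _ ⟨l, hl, rfl⟩
    have h2 : g l - N • u (c l) ∈ radicalSpan (g '' Set.Iio k) :=
      radicalSpan_mono (Set.image_mono (Set.Iio_subset_Iio hl.le))
        (Submodule.span_le.2 (ih l hl) h)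
    simpa using sub_mem h1 h2

/-- If `g k` depended on earlier `g l`, its leading term `u (c k)` would depend on terms of smaller
index, against the greedy choice of `c k`. -/
theorem linearIndependent_triangular : LinearIndependent ℤ g := by
  refine linearIndependent_of_notMem_radicalSpan _ fun k hk => ?_
  have hck : c k ∈ greedyIndices u := hcr ▸ Set.mem_range_self k
  apply hck
  obtain ⟨N, hN, h⟩ := hg k
  refine mem_radicalSpan_of_smul_mem hN ?_
  have h1 : g k ∈ radicalSpan (u '' Set.Iio (c k)) := by
    refine radicalSpan_le ?_ hk
    rintro _ ⟨l, hl, rfl⟩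
    obtain ⟨N', -, h'⟩ := hg l
    have hlk : c l < c k := hc hl
    rw [← sub_add_cancel (g l) (N' • u (c l))]
    exact add_mem (span_le_radicalSpan _ (Submodule.span_mono
      (Set.image_mono (Set.Iio_subset_Iio hlk.le)) h'))
      (Submodule.smul_mem _ _ (subset_radicalSpan _ ⟨_, hlk, rfl⟩))
  simpa using sub_mem h1 (span_le_radicalSpan _ h)

theorem mem_radicalSpan_triangular (hu : Function.Surjective u) (x : M) :
    x ∈ radicalSpan (Set.range g) := by
  obtain ⟨n, rfl⟩ := hu x
  refine radicalSpan_mono (Set.image_subset_range _ _)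
    (image_Iio_subset_radicalSpan_triangular hc hcr hg (n + 1) ⟨n, ?_, rfl⟩)
  exact Nat.lt_of_lt_of_le (Nat.lt_succ_self n) hc.le_apply

end triangular

/-! ### Factorial tails -/

/-- The discrete analogue of a Taylor tail: the weighted sum of the terms with indices
in `[s, S)`, divided formally by `s !`. -/
def factorialTail (d : ℕ → M) (S s : ℕ) : M :=
  ∑ t ∈ Finset.Ico s S, (t.factorial / s.factorial) • d t

theorem factorialTail_eq_zero {d : ℕ → M} {S s : ℕ} (h : S ≤ s) : factorialTail d S s = 0 := by
  simp [factorialTail, Finset.Ico_eq_empty_of_le h]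

theorem factorialTail_succ {d : ℕ → M} {S : ℕ} (hd : ∀ t, S ≤ t → d t = 0) (s : ℕ) :
    factorialTail d S s = d s + (s + 1) • factorialTail d S (s + 1) := by
  rcases lt_or_ge s S with h | h
  · rw [factorialTail, Finset.sum_eq_sum_Ico_succ_bot h, Nat.div_self (Nat.factorial_pos s),
      one_smul, factorialTail, Finset.smul_sum]
    congr 1
    refine Finset.sum_congr rfl fun t ht => ?_
    rw [smul_smul]
    congr 1
    obtain ⟨q, hq⟩ := Nat.factorial_dvd_factorial (Finset.mem_Ico.1 ht).1
    rw [hq, Nat.mul_div_cancel_left _ (Nat.factorial_pos _), Nat.factorial_succ,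
      mul_comm (s + 1), mul_assoc, Nat.mul_div_cancel_left _ (Nat.factorial_pos _)]
  · rw [factorialTail_eq_zero h, factorialTail_eq_zero (h.trans (Nat.le_succ s)), hd s h]
    simp

theorem factorialTail_zero {d : ℕ → M} {S : ℕ} (hd : ∀ t, S ≤ t → d t = 0) (s : ℕ) :
    factorialTail d S 0 = ∑ t ∈ Finset.range s, t.factorial • d t +
      s.factorial • factorialTail d S s := by
  induction s with
  | zero => simp
  | succ s ih =>
    rw [ih, factorialTail_succ hd s, Finset.sum_range_succ, smul_add, add_assoc, smul_smul,
      Nat.factorial_succ, mul_comm s.factorial]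

theorem map_factorialTail {N : Type*} [AddCommGroup N] (p : M →+ N) (d : ℕ → M) (S s : ℕ) :
    p (factorialTail d S s) = factorialTail (fun t => p (d t)) S s := by
  simp [factorialTail]

/-- A converging sequence of indices, never above its limit, gives a weighted sum whose leading
term is a nonzero multiple of the term at the limit. -/
theorem exists_leading_term (u : ℕ → M) (c : ℕ → ℕ) (C : ℕ) (hle : ∀ t, c t ≤ C) {T : ℕ}
    (hT : c T = C) {S : ℕ} (hS : T < S) :
    ∃ N : ℤ, N ≠ 0 ∧ (∑ t ∈ Finset.range S, t.factorial •
      (if t = 0 ∨ c t ≠ c (t - 1) then u (c t) else 0)) - N • u C ∈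
      Submodule.span ℤ (u '' Set.Iio C) := by
  -- `N` is the sum of `t !` over the stages at which the value `C` is newly adopted. All weights
  -- are positive, so nothing cancels.
  suffices H : ∀ S, ∃ N : ℕ, ((∃ t < S, c t = C) → 0 < N) ∧ (∑ t ∈ Finset.range S, t.factorial •
      (if t = 0 ∨ c t ≠ c (t - 1) then u (c t) else 0)) - (N : ℤ) • u C ∈
      Submodule.span ℤ (u '' Set.Iio C) by
    obtain ⟨N, hN, h⟩ := H S
    exact ⟨N, by have := hN ⟨T, hS, hT⟩; omega, h⟩
  intro S
  induction S with
  | zero => exact ⟨0, by simp, by simp⟩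
  | succ S ih =>
    obtain ⟨N, hN, h⟩ := ih
    rw [Finset.sum_range_succ]
    by_cases hS : S = 0 ∨ c S ≠ c (S - 1)
    · rw [if_pos hS]
      by_cases hC : c S = C
      · refine ⟨N + S.factorial, fun _ => by have := Nat.factorial_pos S; omega, ?_⟩
        rw [hC]
        convert h using 1
        rw [Nat.cast_add, add_smul, natCast_zsmul _ S.factorial]
        abel
      · refine ⟨N, fun ⟨t, ht, htC⟩ => hN ⟨t, ?_, htC⟩, ?_⟩
        · rcases Nat.lt_succ_iff_lt_or_eq.1 ht with h | rfl
          exacts [h, absurd htC hC]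
        · rw [add_sub_right_comm]
          have hS' : u (c S) ∈ u '' Set.Iio C := ⟨_, lt_of_le_of_ne (hle S) hC, rfl⟩
          exact add_mem h (nsmul_mem (Submodule.subset_span hS') _)
    · rw [if_neg hS, smul_zero, add_zero]
      refine ⟨N, fun ⟨t, ht, htC⟩ => hN ?_, h⟩
      push Not at hS
      rcases Nat.lt_succ_iff_lt_or_eq.1 ht with h | rfl
      -- A value kept at the last stage already occurred one stage earlier.
      exacts [⟨t, h, htC⟩, ⟨t - 1, by omega, by rw [← hS.2, htC]⟩]

end radicalSpan

/-! ### Transport along effective numberings -/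

namespace InverseSequence

/-- A levelwise isomorphism of inverse sequences induces a topological isomorphism of the limits. -/
def invLimitCongr {A B : InverseSequence} (e : ∀ i, B.dom i ≃+ A.dom i)
    (he : ∀ i x, e i (B.map i x) = A.map i (e (i + 1) x)) : A.invLimit ≃ₜ+ B.invLimit where
  toFun g := ⟨fun i => (e i).symm (g.1 i), fun i => (e i).injective (by
    rw [he, AddEquiv.apply_symm_apply, AddEquiv.apply_symm_apply]; exact g.2 i)⟩
  invFun g := ⟨fun i => e i (g.1 i), fun i => by rw [← he]; exact congrArg (e i) (g.2 i)⟩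
  left_inv g := by ext; simp
  right_inv g := by ext; simp
  map_add' g h := by
    ext i
    exact congrArg Subtype.val (map_add (e i).symm (g.1 i) (h.1 i))
  continuous_toFun := Continuous.subtype_mk (continuous_pi fun i =>
    continuous_of_discreteTopology.comp ((continuous_apply i).comp continuous_subtype_val)) _
  continuous_invFun := Continuous.subtype_mk (continuous_pi fun i =>
    continuous_of_discreteTopology.comp ((continuous_apply i).comp continuous_subtype_val)) _

section transport

variable (A : InverseSequence) (β : ∀ i, ℕ ≃ A.dom i)

/-- The natural numbers, with the group structure of `A i` transported along `β i`. -/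
def TransportedGroup (_ : ∀ i, ℕ ≃ A.dom i) (_ : ℕ) : Type := (Set.univ : Set ℕ)

instance (i : ℕ) : AddCommGroup (TransportedGroup A β i) :=
  ((Equiv.Set.univ ℕ).trans (β i)).addCommGroup

def TransportedGroup.equiv (i : ℕ) : TransportedGroup A β i ≃+ A.dom i :=
  { (Equiv.Set.univ ℕ).trans (β i) with
    map_add' := fun _ _ => Equiv.apply_symm_apply ((Equiv.Set.univ ℕ).trans (β i)) _ }

def TransportedGroup.map (i : ℕ) : TransportedGroup A β (i + 1) →+ TransportedGroup A β i :=
  ((TransportedGroup.equiv A β i).symm.toAddMonoidHom.comp (A.map i)).comp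
    (TransportedGroup.equiv A β (i + 1)).toAddMonoidHom

/-- The copy of `A` with domains `ℕ` given by bijections of `ℕ` with the groups `A i`. -/
def transport : InverseSequence where
  dom _ := Set.univ
  grp i := inferInstanceAs (AddCommGroup (TransportedGroup A β i))
  map i := TransportedGroup.map A β i
  map_surjective i := ((TransportedGroup.equiv A β i).symm.surjective.comp
      (A.map_surjective i)).comp (TransportedGroup.equiv A β (i + 1)).surjective

def transportEquiv (i : ℕ) : (A.transport β).dom i ≃+ A.dom i :=
  TransportedGroup.equiv A β i

theorem transportEquiv_apply (i : ℕ) (x : (A.transport β).dom i) :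
    A.transportEquiv β i x = β i x.1 := rfl

theorem transportEquiv_map (i : ℕ) (x : (A.transport β).dom (i + 1)) :
    A.transportEquiv β i ((A.transport β).map i x) = A.map i (A.transportEquiv β (i + 1) x) :=
  (TransportedGroup.equiv A β i).apply_symm_apply
    (A.map i (TransportedGroup.equiv A β (i + 1) x))

end transport

/-- A uniformly computable system of codes, with decidable equality, for the groups of an inverse
sequence. The decoding maps are not assumed to be computable. -/
structure EffectiveNumbering (A : InverseSequence) (K : Type) [Primcodable K] where
  val : ∀ i, K → A.dom i
  surjective : ∀ i, Function.Surjective (val i)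
  eq : ComputablePred fun p : ℕ × K × K => val p.1 p.2.1 = val p.1 p.2.2
  add : ∃ f : ℕ × K × K → K, Computable f ∧ ∀ i x y, val i (f (i, x, y)) = val i x + val i y
  neg : ∃ f : ℕ × K → K, Computable f ∧ ∀ i x, val i (f (i, x)) = -val i x
  map : ∃ f : ℕ × K → K, Computable f ∧ ∀ i x, val i (f (i, x)) = A.map i (val (i + 1) x)
  ker : ∃ f : ℕ × ℕ → K, Computable f ∧
    ∀ i (a : A.dom (i + 1)), A.map i a = 0 → val (i + 1) (f (i, (a : ℕ))) = a

namespace EffectiveNumbering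

variable {A : InverseSequence} {K : Type} [Primcodable K] (ν : EffectiveNumbering A K)

-- Codes that come first among those with their value form an infinite decidable set of
-- representatives, which is enumerated in increasing order.
include ν in
theorem exists_bijective (hinf : ∀ i, Infinite (A.dom i)) :
    ∃ (β : ∀ i, ℕ ≃ A.dom i) (c : ℕ × ℕ → K), Computable c ∧ ∀ i n, ν.val i (c (i, n)) = β i n := by
  obtain ⟨k₀, -⟩ := ν.surjective 0 0
  let dec : ℕ → K := fun n => (Encodable.decode n).getD k₀
  have hdec : Computable dec := Computable.option_getD Computable.decode (Computable.const k₀)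
  have hsurj : ∀ i (x : A.dom i), ∃ n, ν.val i (dec n) = x := fun i x => by
    obtain ⟨k, hk⟩ := ν.surjective i x
    exact ⟨Encodable.encode k, by simp [dec, hk]⟩
  let rep : ℕ × ℕ → Prop := fun p => ∀ m < p.2, ν.val p.1 (dec m) ≠ ν.val p.1 (dec p.2)
  have hrep : ComputablePred rep :=
    ComputablePred.forall_lt (p := fun q : (ℕ × ℕ) × ℕ =>
      ¬ ν.val q.1.1 (dec q.2) = ν.val q.1.1 (dec q.1.2))
      (ν.eq.comp ((Computable.fst.comp Computable.fst).pair
        ((hdec.comp Computable.snd).pair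
          (hdec.comp (Computable.snd.comp Computable.fst))))).not Computable.snd
  have hexrep : ∀ i (x : A.dom i), ∃ n, rep (i, n) ∧ ν.val i (dec n) = x := fun i x => by
    classical
    refine ⟨Nat.find (hsurj i x), fun m hm h => ?_, Nat.find_spec (hsurj i x)⟩
    exact Nat.find_min (hsurj i x) hm (h.trans (Nat.find_spec (hsurj i x)))
  have hrepinj : ∀ i m n, rep (i, m) → rep (i, n) → ν.val i (dec m) = ν.val i (dec n) → m = n := by
    intro i m n hm hn h
    rcases lt_trichotomy m n with h' | h' | h'
    exacts [absurd h (hn m h'), h', absurd h.symm (hm n h')]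
  have hrepinf : ∀ i, {n | rep (i, n)}.Infinite := fun i hfin => by
    have : (Set.univ : Set (A.dom i)).Finite :=
      (hfin.image fun n => ν.val i (dec n)).subset fun x _ => by
        obtain ⟨n, hn, h⟩ := hexrep i x
        exact ⟨n, hn, h⟩
    exact Set.infinite_univ this
  let r : ℕ × ℕ → ℕ := fun p => Nat.nth (fun n => rep (p.1, n)) p.2
  have hr : Computable r :=
    Computable.nth (α := ℕ × ℕ) (p := fun q => rep (q.1.1, q.2))
      (hrep.comp ((Computable.fst.comp Computable.fst).pair Computable.snd))
      (fun a => hrepinf a.1) Computable.snd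
  refine ⟨fun i => Equiv.ofBijective (fun n => ν.val i (dec (r (i, n)))) ⟨fun m n h => ?_,
    fun x => ?_⟩, fun p => dec (r p), hdec.comp hr, fun i n => rfl⟩
  · exact Nat.nth_injective (hrepinf i) (hrepinj i _ _
      (Nat.nth_mem_of_infinite (hrepinf i) m) (Nat.nth_mem_of_infinite (hrepinf i) n) h)
  · obtain ⟨n, hn, h⟩ := hexrep i x
    have : n ∈ Set.range (Nat.nth fun n => rep (i, n)) := by
      rw [Nat.range_nth_of_infinite (hrepinf i)]; exact hn
    obtain ⟨k, hk⟩ := this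
    exact ⟨k, by simp only [r, hk, h]⟩

variable {β : ∀ i, ℕ ≃ A.dom i} {c : ℕ × ℕ → K} (hc : Computable c)
  (hβ : ∀ i n, ν.val i (c (i, n)) = β i n)

include hc hβ

/-- Although `val` need not be computable, the number is found by search, comparing codes only. -/
theorem computable_symm {α : Type*} [Primcodable α] {i : α → ℕ} (hi : Computable i) {k : α → K}
    (hk : Computable k) : Computable fun a => (β (i a)).symm (ν.val (i a) (k a)) := by
  refine Computable.of_graph (ν.eq.comp ((hi.comp Computable.fst).pair
    ((hc.comp ((hi.comp Computable.fst).pair Computable.snd)).pair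
      (hk.comp Computable.fst)))) fun a n => ?_
  rw [hβ, Equiv.eq_symm_apply]

theorem isComputable_transport : (A.transport β).IsComputable where
  dom := (ComputablePred.eq (Computable.const 0) (Computable.const 0)).of_eq
    fun p => ⟨fun _ => Set.mem_univ _, fun _ => rfl⟩
  add := by
    obtain ⟨f, hf, hfs⟩ := ν.add
    have hx : Computable fun p : ℕ × ℕ × ℕ => c (p.1, p.2.1) :=
      hc.comp (Computable.fst.pair (Computable.fst.comp Computable.snd))
    have hy : Computable fun p : ℕ × ℕ × ℕ => c (p.1, p.2.2) :=
      hc.comp (Computable.fst.pair (Computable.snd.comp Computable.snd))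
    refine ⟨_, ν.computable_symm hc hβ Computable.fst
      (hf.comp (Computable.fst.pair (hx.pair hy))), fun i x y => ?_⟩
    rw [Equiv.symm_apply_eq, hfs, hβ, hβ]
    exact (map_add (A.transportEquiv β i) x y).symm
  neg := by
    obtain ⟨f, hf, hfs⟩ := ν.neg
    refine ⟨_, ν.computable_symm hc hβ Computable.fst
      (hf.comp (Computable.fst.pair hc)), fun i x => ?_⟩
    rw [Equiv.symm_apply_eq, hfs, hβ]
    exact (map_neg (A.transportEquiv β i) x).symm
  map := by
    obtain ⟨f, hf, hfs⟩ := ν.map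
    refine ⟨_, ν.computable_symm hc hβ Computable.fst
      (hf.comp (Computable.fst.pair (hc.comp
        ((Computable.succ.comp Computable.fst).pair Computable.snd)))), fun i x => ?_⟩
    rw [Equiv.symm_apply_eq, hfs, hβ]
    exact (A.transportEquiv_map β i x).symm

theorem hasComputableKernels_transport (hA : A.IsComputable) (hker : A.HasComputableKernels) :
    (A.transport β).HasComputableKernels := by
  classical
  obtain ⟨K', hK', hKs⟩ := hker
  obtain ⟨f, hf, hfs⟩ := ν.ker
  have hmem : ∀ i n, n ∈ K' i ↔ n ∈ A.dom (i + 1) ∧ A.map i (A.elem (i + 1) n) = 0 := by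
    intro i n
    rw [← Finset.mem_coe, hKs]
    constructor
    · rintro ⟨x, hx, rfl⟩
      exact ⟨x.2, by simpa using hx⟩
    · rintro ⟨h, h'⟩
      exact ⟨⟨n, h⟩, by simpa [elem, h] using h', rfl⟩
  have hKc : ComputablePred fun p : ℕ × ℕ => p.2 ∈ K' p.1 := by
    have hs : Computable fun p : ℕ × ℕ => p.1 + 1 := Computable.succ.comp Computable.fst
    refine ((hA.mem_dom hs Computable.snd).and (ComputablePred.eq
      (hA.computable_map Computable.fst (hA.computable_elem hs Computable.snd))
      (hA.computable_zero Computable.fst))).of_eq fun p => ?_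
    rw [hmem, Subtype.ext_iff]
  let ι : ℕ → ℕ → ℕ := fun i n => (β (i + 1)).symm (ν.val (i + 1) (f (i, n)))
  have hι : Computable fun p : ℕ × ℕ => ι p.1 p.2 :=
    ν.computable_symm hc hβ (Computable.succ.comp Computable.fst) hf
  have hιval : ∀ i n, n ∈ K' i → β (i + 1) (ι i n) = A.elem (i + 1) n := by
    intro i n hn
    obtain ⟨h, h'⟩ := (hmem i n).1 hn
    have := hfs i (A.elem (i + 1) n) h'
    simp only [ι, Equiv.apply_symm_apply]
    rwa [show ((A.elem (i + 1) n : A.dom (i + 1)) : ℕ) = n by simp [elem, h]] at this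
  have hinj : ∀ i, Set.InjOn (ι i) (K' i : Set ℕ) := by
    intro i m hm n hn h
    have h1 := hιval i m hm
    rw [h, hιval i n hn] at h1
    simpa [elem, ((hmem i m).1 hm).1, ((hmem i n).1 hn).1] using h1.symm
  refine ⟨fun i => (K' i).image (ι i), ?_, fun i => ?_⟩
  · refine (Computable.sum_range (f := fun p : ℕ × ℕ => if p.2 ∈ K' p.1 then 2 ^ ι p.1 p.2 else 0)
      (Computable.ite_pred hKc (Computable.two_pow hι) (Computable.const 0)) hK').of_eq fun i => ?_
    simp only [strongIndex]
    rw [Finset.sum_image (hinj i), ← Finset.sum_filter]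
    refine Finset.sum_congr ?_ fun _ _ => rfl
    ext n
    simp only [Finset.mem_filter, Finset.mem_range, and_iff_right_iff_imp]
    -- Since `n < 2 ^ n`, the strong index itself bounds the elements of the kernel, hence the range
    -- of summation.
    exact fun hn => Nat.lt_of_lt_of_le n.lt_two_pow_self
      (Finset.single_le_sum (f := fun n => 2 ^ n) (fun _ _ => Nat.zero_le _) hn)
  · ext k
    simp only [Finset.coe_image, Set.mem_image, Finset.mem_coe]
    constructor
    · rintro ⟨n, hn, rfl⟩
      refine ⟨⟨ι i n, Set.mem_univ _⟩, (A.transportEquiv β i).injective ?_, rfl⟩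
      rw [transportEquiv_map, map_zero, transportEquiv_apply, hιval i n hn]
      exact ((hmem i n).1 hn).2
    · rintro ⟨x, hx, rfl⟩
      have hx' : A.map i (β (i + 1) x.1) = 0 := by
        rw [← transportEquiv_apply, ← transportEquiv_map, show (A.transport β).map i x = 0 from hx,
          map_zero]
      have hn : (β (i + 1) x.1 : ℕ) ∈ K' i := (hmem _ _).2 ⟨(β (i + 1) x.1).2, by simpa using hx'⟩
      exact ⟨_, hn, (β (i + 1)).injective (by rw [hιval i _ hn, elem_coe])⟩

end EffectiveNumbering

end InverseSequence

/-! ### Stage codes -/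

section linearCombination

variable {M N : Type*} [AddCommGroup M] [AddCommGroup N]

theorem linearCombination_add_fun (u v : ℕ → M) (z : ℕ →₀ ℤ) :
    Finsupp.linearCombination ℤ (fun k => u k + v k) z =
      Finsupp.linearCombination ℤ u z + Finsupp.linearCombination ℤ v z := by
  simp [Finsupp.linearCombination_apply, Finsupp.sum_add]

theorem linearCombination_nsmul_fun (c : ℕ) (u : ℕ → M) (z : ℕ →₀ ℤ) :
    Finsupp.linearCombination ℤ (fun k => c • u k) z =
      c • Finsupp.linearCombination ℤ u z := by
  simp only [Finsupp.linearCombination_apply, Finsupp.sum, Finset.smul_sum]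
  exact Finset.sum_congr rfl fun k _ => smul_comm _ _ _

theorem map_linearCombination_int (p : M →+ N) (u : ℕ → M) (z : ℕ →₀ ℤ) :
    p (Finsupp.linearCombination ℤ u z) = Finsupp.linearCombination ℤ (fun k => p (u k)) z := by
  simp [Finsupp.linearCombination_apply, Finsupp.sum]

end linearCombination

theorem CoeffWord.lt_length_of_vec_ne_zero {w : CoeffWord} {k : ℕ} (h : w.vec k ≠ 0) :
    k < w.1.length + w.2.length := by
  by_contra hk
  rw [vec_apply, List.getD_eq_default _ _ (by omega), List.getD_eq_default _ _ (by omega)] at h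
  simp at h

namespace InverseSequence

/-- If `m` kills the image of `x` one level down, then `m • x` lies in a finite kernel and has
finite order. -/
theorem HasComputableKernels.exists_smul_eq_zero {A : InverseSequence}
    (hA : A.HasComputableKernels) (i : ℕ) (x : A.dom i) (hx : A.proj i x = 0) :
    ∃ m : ℤ, m ≠ 0 ∧ m • x = 0 := by
  obtain ⟨K, -, hK⟩ := hA
  induction i with
  | zero => exact ⟨1, one_ne_zero, by rw [one_smul]; exact hx⟩
  | succ i ih =>
    obtain ⟨m, hm, h⟩ := ih (A.map i x) hx
    have hfin : Finite (A.map i).ker := by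
      have : (Subtype.val '' {x : A.dom (i + 1) | A.map i x = 0}).Finite :=
        hK i ▸ (K i).finite_toSet
      exact (this.of_finite_image Subtype.val_injective.injOn).to_subtype
    have h' : m • x ∈ (A.map i).ker := by rw [AddMonoidHom.mem_ker, map_zsmul, h]
    obtain ⟨n, hn, hn'⟩ := (isOfFinAddOrder_of_finite
      (⟨m • x, h'⟩ : (A.map i).ker)).exists_nsmul_eq_zero
    refine ⟨n * m, mul_ne_zero (by omega) hm, ?_⟩
    have := congrArg Subtype.val hn'
    rw [mul_smul, natCast_zsmul]
    exact this

section increments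

variable (A : InverseSequence) (d : ℕ → ℕ → A.dom 0) (S : ℕ → ℕ)

/-- Increments are lifted before they are summed, as `lift` need not be additive. The bound `S` is
not assumed computable, so tails occur in values of codes but never in algorithms. -/
noncomputable def tailAt (i s k : ℕ) : A.dom i :=
  factorialTail (fun t => A.lift (d t k) i) (S k) s

noncomputable def partialSum (s k : ℕ) : A.dom 0 :=
  ∑ t ∈ Finset.range s, t.factorial • d t k

theorem proj_tailAt (i s k : ℕ) : A.proj i (A.tailAt d S i s k) = A.tailAt d S 0 s k := by
  simp only [tailAt, map_factorialTail, proj_lift]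
  rfl

/-- The codes `(s, n, w)` consist of a stage, the number of an element, and coefficients. -/
abbrev StageCode := ℕ × ℕ × CoeffWord

namespace StageCode

noncomputable def value (i : ℕ) (x : StageCode) : A.dom i :=
  A.elem i x.2.1 + Finsupp.linearCombination ℤ (A.tailAt d S i x.1) x.2.2.vec

def Valid (i : ℕ) (x : StageCode) : Prop :=
  x.1.factorial • A.proj i (A.elem i x.2.1) =
    Finsupp.linearCombination ℤ (A.partialSum d x.1) x.2.2.vec

/-- The code with the same value at the next stage. -/
noncomputable def step (i : ℕ) (x : StageCode) : StageCode :=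
  (x.1 + 1, ((A.elem i x.2.1 +
    Finsupp.linearCombination ℤ (fun k => A.lift (d x.1 k) i) x.2.2.vec : A.dom i) : ℕ),
    x.2.2.scale (x.1 + 1))

-- Invalid codes are read as the zero code, so that `val` is total.
open Classical in
noncomputable def validate (i : ℕ) (x : StageCode) : StageCode :=
  if Valid A d i x then x else (0, ((0 : A.dom i) : ℕ), ([], []))

noncomputable def val (i : ℕ) (x : StageCode) : A.dom i := value A d S i (validate A d i x)

/-- The code `x`, taken to a stage shared with `y`. -/
noncomputable def align (i : ℕ) (x y : StageCode) : StageCode :=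
  (step A d i)^[(validate A d i y).1] (validate A d i x)

variable {A d S}

section

variable (hS : ∀ k t, S k ≤ t → d t k = 0)
include hS

theorem lift_eq_zero (i k t : ℕ) (h : S k ≤ t) : A.lift (d t k) i = 0 := by
  rw [hS k t h, lift_zero]

/-- Adding `s !` times the combination of tails to both sides completes the partial sums to the full
sums. -/
theorem valid_iff (i : ℕ) (x : StageCode) : Valid A d i x ↔
    x.1.factorial • A.proj i (value A d S i x) =
      Finsupp.linearCombination ℤ (A.tailAt d S 0 0) x.2.2.vec := by
  have h : A.tailAt d S 0 0 = fun k =>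
      A.partialSum d x.1 k + x.1.factorial • A.proj i (A.tailAt d S i x.1 k) := by
    funext k
    simp only [tailAt, partialSum, map_factorialTail, proj_lift]
    exact factorialTail_zero (hS k) x.1
  rw [h, linearCombination_add_fun, linearCombination_nsmul_fun, ← map_linearCombination_int,
    value, map_add, smul_add, add_left_inj, Valid]

theorem value_step (i : ℕ) (x : StageCode) :
    value A d S i (step A d i x) = value A d S i x := by
  have h : A.tailAt d S i x.1 = fun k =>
      A.lift (d x.1 k) i + (x.1 + 1) • A.tailAt d S i (x.1 + 1) k := by
    funext k
    exact factorialTail_succ (lift_eq_zero hS i k) x.1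
  simp only [value, step, elem_coe, CoeffWord.vec_scale, map_nsmul]
  rw [h, linearCombination_add_fun, linearCombination_nsmul_fun, add_assoc]

theorem valid_step (i : ℕ) (x : StageCode) (hx : Valid A d i x) :
    Valid A d i (step A d i x) := by
  rw [valid_iff hS] at hx ⊢
  rw [value_step hS]
  simp only [step, CoeffWord.vec_scale, map_nsmul]
  rw [← hx, Nat.factorial_succ, mul_smul]

theorem value_iterate_step (i : ℕ) (x : StageCode) (r : ℕ) :
    value A d S i ((step A d i)^[r] x) = value A d S i x := by
  induction r with
  | zero => rfl
  | succ r ih => rw [Function.iterate_succ_apply', value_step hS, ih]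

theorem valid_iterate_step (i : ℕ) (x : StageCode) (hx : Valid A d i x) (r : ℕ) :
    Valid A d i ((step A d i)^[r] x) := by
  induction r with
  | zero => exact hx
  | succ r ih => rw [Function.iterate_succ_apply']; exact valid_step hS i _ ih

theorem value_align (i : ℕ) (x y : StageCode) :
    value A d S i (align A d i x y) = val A d S i x := value_iterate_step hS _ _ _

end

theorem stage_iterate_step (i : ℕ) (x : StageCode) (r : ℕ) :
    ((step A d i)^[r] x).1 = x.1 + r := by
  induction r with
  | zero => rfl
  | succ r ih => rw [Function.iterate_succ_apply', step, ih, add_assoc]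

theorem stage_align_comm (i : ℕ) (x y : StageCode) :
    (align A d i x y).1 = (align A d i y x).1 := by
  rw [align, align, stage_iterate_step, stage_iterate_step, add_comm]

theorem valid_validate (i : ℕ) (x : StageCode) : Valid A d i (validate A d i x) := by
  classical
  unfold validate
  split_ifs with h
  · exact h
  · simp [Valid]

theorem val_of_valid {i : ℕ} {x : StageCode} (hx : Valid A d i x) :
    val A d S i x = value A d S i x := by
  rw [val, validate, if_pos hx]

theorem valid_align (hS : ∀ k t, S k ≤ t → d t k = 0) (i : ℕ) (x y : StageCode) :
    Valid A d i (align A d i x y) := valid_iterate_step hS _ _ (valid_validate i x) _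

variable (hS : ∀ k t, S k ≤ t → d t k = 0) (hli : LinearIndependent ℤ (A.tailAt d S 0 0))
include hS hli

theorem value_eq_iff {i : ℕ} {x y : StageCode} (hx : Valid A d i x) (hy : Valid A d i y)
    (hxy : x.1 = y.1) : value A d S i x = value A d S i y ↔
      A.elem i x.2.1 = A.elem i y.2.1 ∧ x.2.2.vec = y.2.2.vec := by
  constructor
  · intro h
    rw [valid_iff hS] at hx hy
    rw [h, hxy, hy] at hx
    have hz : x.2.2.vec = y.2.2.vec := (hli hx).symm
    rw [value, value, hz, hxy, add_left_inj] at h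
    exact ⟨h, hz⟩
  · rintro ⟨h, h'⟩
    rw [value, value, h, h', hxy]

theorem val_eq_iff (i : ℕ) (x y : StageCode) : val A d S i x = val A d S i y ↔
    (A.elem i (align A d i x y).2.1 = A.elem i (align A d i y x).2.1 ∧
      (align A d i x y).2.2.vec = (align A d i y x).2.2.vec) := by
  rw [← value_eq_iff hS hli (valid_align hS i x y) (valid_align hS i y x) (stage_align_comm i x y),
    value_align hS, value_align hS]

/-- At stage `s` the coefficients of such a code must be `s !` times the `k`-th unit vector, so the
lists reach beyond `k`. This bounds the search for `k`. -/
theorem lt_length_of_val_eq {i k : ℕ} {x : StageCode} (h : val A d S i x = A.tailAt d S i 0 k) :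
    k < (validate A d i x).2.2.1.length + (validate A d i x).2.2.2.length := by
  have hx := (valid_iff hS i _).1 (valid_validate i x)
  rw [← val, h, proj_tailAt] at hx
  have hs : Finsupp.linearCombination ℤ (A.tailAt d S 0 0)
      ((validate A d i x).1.factorial • Finsupp.single k 1) =
      (validate A d i x).1.factorial • A.tailAt d S 0 0 k := by
    rw [map_nsmul, Finsupp.linearCombination_single, one_smul]
  apply CoeffWord.lt_length_of_vec_ne_zero
  rw [← hli (hs.trans hx)]
  simp [Nat.factorial_ne_zero]

end StageCode

end increments

open StageCode

theorem StageCode.val_surjective {A : InverseSequence} {d : ℕ → ℕ → A.dom 0} {S : ℕ → ℕ}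
    (hS : ∀ k t, S k ≤ t → d t k = 0)
    (hgen : ∀ x, x ∈ radicalSpan (Set.range (A.tailAt d S 0 0))) (i : ℕ) :
    Function.Surjective (val A d S i) := by
  intro y
  obtain ⟨m, hm, h⟩ := hgen (A.proj i y)
  rw [← Finsupp.range_linearCombination] at h
  obtain ⟨z, hz⟩ := h
  -- The first summand makes `m` divide `s !`; the second makes all tails in the combination vanish,
  -- so that `y` is its own first component.
  let s := m.natAbs + z.support.sup S
  obtain ⟨q, hq⟩ : m ∣ (s.factorial : ℤ) := Int.natAbs_dvd.1 (Int.natCast_dvd_natCast.2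
    (Nat.dvd_factorial (Int.natAbs_pos.2 hm) (Nat.le_add_right _ _)))
  obtain ⟨w, hw⟩ := CoeffWord.vec_surjective (q • z)
  have hval : value A d S i (s, (y : ℕ), w) = y := by
    rw [value, elem_coe, hw, map_smul, Finsupp.linearCombination_apply, Finsupp.sum,
      Finset.sum_eq_zero, smul_zero, add_zero]
    intro k hk
    rw [tailAt, factorialTail_eq_zero, smul_zero]
    exact (Finset.le_sup hk).trans (Nat.le_add_left _ _)
  refine ⟨(s, (y : ℕ), w), ?_⟩
  rw [val_of_valid, hval]
  rw [valid_iff hS, hval]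
  simp only [hw, map_smul, hz]
  rw [← natCast_zsmul, hq, mul_comm, mul_smul]

namespace IsComputable

variable {A : InverseSequence} (hA : A.IsComputable) {d : ℕ → ℕ → A.dom 0} {S : ℕ → ℕ}
  (hd : Computable fun p : ℕ × ℕ => (d p.1 p.2 : ℕ)) {α : Type*} [Primcodable α]
include hA hd

theorem computable_step {i : α → ℕ} (hi : Computable i) {x : α → StageCode} (hx : Computable x) :
    Computable fun a => step A d (i a) (x a) := by
  have hs := Computable.fst.comp hx
  have hn := Computable.fst.comp (Computable.snd.comp hx)
  have hw := Computable.snd.comp (Computable.snd.comp hx)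
  have hs1 := Computable.succ.comp hs
  refine hs1.pair (Computable.pair (hA.computable_add hi (hA.computable_elem hi hn)
    (hA.computable_linearCombination hi (u := fun a k => A.lift (d (x a).1 k) (i a))
      (hA.computable_lift (hi.comp Computable.fst)
        (g := fun p : α × ℕ => d (x p.1).1 p.2) ?_) hw))
    (CoeffWord.computable_scale.comp (hs1.pair hw)))
  exact hd.comp ((hs.comp Computable.fst).pair Computable.snd)

theorem computablePred_valid : ComputablePred fun p : ℕ × StageCode => Valid A d p.1 p.2 := by
  have hfac : Computable Nat.factorial := by
    refine (Computable.nat_rec (f := fun n : ℕ => n) (g := fun _ => 1)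
      (h := fun _ (q : ℕ × ℕ) => (q.1 + 1) * q.2) Computable.id (Computable.const 1)
      (Primrec.nat_mul.to_comp.comp (Computable.succ.comp (Computable.fst.comp Computable.snd))
        (Computable.snd.comp Computable.snd)).to₂).of_eq fun n => ?_
    induction n with
    | zero => rfl
    | succ n ih => rw [Nat.factorial_succ, ← ih]
  have hs : Computable fun p : ℕ × StageCode => p.2.1 := Computable.fst.comp Computable.snd
  have hz {β : Type} [Primcodable β] : Computable fun _ : β => 0 := Computable.const 0
  refine (ComputablePred.eq
    (hA.computable_nsmul hz (hA.computable_proj Computable.fst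
      (hA.computable_elem Computable.fst
        (Computable.fst.comp (Computable.snd.comp Computable.snd)))) (hfac.comp hs))
    (hA.computable_linearCombination (α := ℕ × StageCode) hz
      (u := fun p => A.partialSum d p.2.1)
      (hA.computable_sum (α := (ℕ × StageCode) × ℕ) hz
        (g := fun q t => t.factorial • d t q.2)
        (hA.computable_nsmul hz
          (hd.comp (Computable.snd.pair (Computable.snd.comp Computable.fst)))
          (hfac.comp Computable.snd)) (hs.comp Computable.fst))
      (Computable.snd.comp (Computable.snd.comp Computable.snd)))).of_eq fun p => ?_
  rw [← Subtype.ext_iff]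
  rfl

theorem computable_validate {i : α → ℕ} (hi : Computable i) {x : α → StageCode}
    (hx : Computable x) : Computable fun a => validate A d (i a) (x a) := by
  classical
  exact Computable.ite_pred (p := fun a => Valid A d (i a) (x a))
    ((hA.computablePred_valid hd).comp (hi.pair hx)) hx
    ((Computable.const 0).pair ((hA.computable_zero hi).pair (Computable.const ([], []))))

theorem computable_align {i : α → ℕ} (hi : Computable i) {x y : α → StageCode}
    (hx : Computable x) (hy : Computable y) :
    Computable fun a => align A d (i a) (x a) (y a) := by
  refine (Computable.nat_rec (h := fun a (q : ℕ × StageCode) => step A d (i a) q.2)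
    (Computable.fst.comp (hA.computable_validate hd hi hy)) (hA.computable_validate hd hi hx)
    (hA.computable_step hd (hi.comp Computable.fst)
      (Computable.snd.comp Computable.snd)).to₂).of_eq fun a => ?_
  unfold align
  induction (validate A d (i a) (y a)).1 with
  | zero => rfl
  | succ n ih => rw [Function.iterate_succ_apply', ← ih]

end IsComputable

/-- The numbering of `A` by stage codes. -/
noncomputable def stageNumbering {A : InverseSequence} (hA : A.IsComputable)
    {d : ℕ → ℕ → A.dom 0} (hd : Computable fun p : ℕ × ℕ => (d p.1 p.2 : ℕ)) {S : ℕ → ℕ}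
    (hS : ∀ k t, S k ≤ t → d t k = 0) (hli : LinearIndependent ℤ (A.tailAt d S 0 0))
    (hgen : ∀ x, x ∈ radicalSpan (Set.range (A.tailAt d S 0 0))) :
    EffectiveNumbering A StageCode where
  val := val A d S
  surjective := val_surjective hS hgen
  eq := by
    have hx : Computable fun p : ℕ × StageCode × StageCode => align A d p.1 p.2.1 p.2.2 :=
      hA.computable_align hd Computable.fst (Computable.fst.comp Computable.snd)
        (Computable.snd.comp Computable.snd)
    have hy : Computable fun p : ℕ × StageCode × StageCode => align A d p.1 p.2.2 p.2.1 :=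
      hA.computable_align hd Computable.fst (Computable.snd.comp Computable.snd)
        (Computable.fst.comp Computable.snd)
    refine ((ComputablePred.eq
      (hA.computable_elem Computable.fst (Computable.fst.comp (Computable.snd.comp hx)))
      (hA.computable_elem Computable.fst (Computable.fst.comp (Computable.snd.comp hy)))).and
      (CoeffWord.computablePred_vec_eq.comp ((Computable.snd.comp (Computable.snd.comp hx)).pair
        (Computable.snd.comp (Computable.snd.comp hy))))).of_eq fun p => ?_
    rw [val_eq_iff hS hli, Subtype.ext_iff]
  add := by
    have hx : Computable fun p : ℕ × StageCode × StageCode => align A d p.1 p.2.1 p.2.2 :=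
      hA.computable_align hd Computable.fst (Computable.fst.comp Computable.snd)
        (Computable.snd.comp Computable.snd)
    have hy : Computable fun p : ℕ × StageCode × StageCode => align A d p.1 p.2.2 p.2.1 :=
      hA.computable_align hd Computable.fst (Computable.snd.comp Computable.snd)
        (Computable.fst.comp Computable.snd)
    refine ⟨_, (Computable.fst.comp hx).pair ((hA.computable_add Computable.fst
      (hA.computable_elem Computable.fst (Computable.fst.comp (Computable.snd.comp hx)))
      (hA.computable_elem Computable.fst (Computable.fst.comp (Computable.snd.comp hy)))).pair
      (CoeffWord.computable_add.comp ((Computable.snd.comp (Computable.snd.comp hx)).pair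
        (Computable.snd.comp (Computable.snd.comp hy))))), fun i x y => ?_⟩
    have hval : ∀ a b : StageCode, a.1 = b.1 → value A d S i (a.1,
        ((A.elem i a.2.1 + A.elem i b.2.1 : A.dom i) : ℕ), a.2.2.add b.2.2) =
        value A d S i a + value A d S i b := by
      intro a b hab
      simp only [value, elem_coe, CoeffWord.vec_add, map_add, hab]
      abel
    have hst := stage_align_comm (A := A) (d := d) i x y
    rw [val_of_valid, hval _ _ hst, value_align hS, value_align hS]
    rw [valid_iff hS, hval _ _ hst]
    have h1 := (valid_iff hS i _).1 (valid_align hS i x y)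
    have h2 := (valid_iff hS i _).1 (valid_align hS i y x)
    rw [← hst] at h2
    simp only [map_add, smul_add, CoeffWord.vec_add, h1, h2]
  neg := by
    have hx : Computable fun p : ℕ × StageCode => validate A d p.1 p.2 :=
      hA.computable_validate hd Computable.fst Computable.snd
    refine ⟨_, (Computable.fst.comp hx).pair ((hA.computable_neg Computable.fst
      (hA.computable_elem Computable.fst (Computable.fst.comp (Computable.snd.comp hx)))).pair
      (CoeffWord.computable_neg.comp (Computable.snd.comp (Computable.snd.comp hx)))),
      fun i x => ?_⟩
    have hval : ∀ a : StageCode, value A d S i (a.1, ((-A.elem i a.2.1 : A.dom i) : ℕ),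
        a.2.2.neg) = -value A d S i a := by
      intro a
      simp only [value, elem_coe, CoeffWord.vec_neg, map_neg, neg_add]
    rw [val_of_valid, hval, val]
    rw [valid_iff hS, hval]
    have h1 := (valid_iff hS i _).1 (valid_validate i x)
    simp only [map_neg, smul_neg, CoeffWord.vec_neg, h1]
  map := by
    have hs : Computable fun p : ℕ × StageCode => p.1 + 1 := Computable.succ.comp Computable.fst
    have hx : Computable fun p : ℕ × StageCode => validate A d (p.1 + 1) p.2 :=
      hA.computable_validate hd hs Computable.snd
    refine ⟨_, (Computable.fst.comp hx).pair ((hA.computable_map Computable.fst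
      (hA.computable_elem hs (Computable.fst.comp (Computable.snd.comp hx)))).pair
      (Computable.snd.comp (Computable.snd.comp hx))), fun i x => ?_⟩
    -- Lifts are compatible with the projections, so tails map to tails and the coefficients do not
    -- change.
    have hval : ∀ a : StageCode, value A d S i (a.1, (A.map i (A.elem (i + 1) a.2.1) : ℕ),
        a.2.2) = A.map i (value A d S (i + 1) a) := by
      intro a
      simp only [value, elem_coe, map_add, map_linearCombination_int, tailAt, map_factorialTail,
        map_lift]
      rfl
    rw [val_of_valid, hval, val]
    rw [valid_iff hS, hval]
    exact (valid_iff hS (i + 1) _).1 (valid_validate (i + 1) x)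
  ker := by
    -- A kernel element projects to zero in `A 0`, so it is valid with empty coefficients.
    refine ⟨fun p => (0, p.2, ([], [])), (Computable.const 0).pair
      (Computable.snd.pair (Computable.const ([], []))), fun i a ha => ?_⟩
    rw [val_of_valid]
    · simp [value]
    · simp [Valid, proj_succ_apply, ha]

theorem computablePred_val_mem_range {A : InverseSequence} (hA : A.IsComputable)
    {d : ℕ → ℕ → A.dom 0} (hd : Computable fun p : ℕ × ℕ => (d p.1 p.2 : ℕ)) {S : ℕ → ℕ}
    (hS : ∀ k t, S k ≤ t → d t k = 0) (hli : LinearIndependent ℤ (A.tailAt d S 0 0))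
    (hgen : ∀ x, x ∈ radicalSpan (Set.range (A.tailAt d S 0 0))) :
    ComputablePred fun p : ℕ × StageCode =>
      val A d S p.1 p.2 ∈ Set.range (A.tailAt d S p.1 0) := by
  have hx : Computable fun p : ℕ × StageCode => validate A d p.1 p.2 :=
    hA.computable_validate hd Computable.fst Computable.snd
  have hw := Computable.snd.comp (Computable.snd.comp hx)
  have hcode : Computable fun q : (ℕ × StageCode) × ℕ =>
      ((0, ((0 : A.dom q.1.1) : ℕ), CoeffWord.single q.2) : StageCode) :=
    (Computable.const 0).pair ((hA.computable_zero (Computable.fst.comp Computable.fst)).pair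
      (CoeffWord.computable_single.comp Computable.snd))
  have hval : ∀ i k, val A d S i (0, ((0 : A.dom i) : ℕ), CoeffWord.single k) =
      A.tailAt d S i 0 k := by
    intro i k
    rw [val_of_valid]
    · simp [value]
    · simp [Valid, partialSum]
  refine (((stageNumbering hA hd hS hli hgen).eq.comp
    ((Computable.fst.comp Computable.fst).pair
      ((Computable.snd.comp Computable.fst).pair hcode))).exists_lt
    (Primrec.nat_add.to_comp.comp (Computable.list_length.comp (Computable.fst.comp hw))
      (Computable.list_length.comp (Computable.snd.comp hw)))).of_eq fun p => ?_
  constructor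
  · rintro ⟨k, -, h⟩
    exact ⟨k, ((h : val A d S _ _ = val A d S _ _).trans (hval _ _)).symm⟩
  · rintro ⟨k, h⟩
    exact ⟨k, lt_length_of_val_eq hS hli h.symm, h.symm.trans (hval _ _).symm⟩

end InverseSequence

/-! ### Approximating the greedy basis, and the two cases -/

namespace InverseSequence

theorem elem_surjective (A : InverseSequence) (i : ℕ) : Function.Surjective (A.elem i) :=
  fun x => ⟨x, A.elem_coe i x⟩

theorem IsComputable.exists_dependence_witness {A : InverseSequence} (hA : A.IsComputable) :
    ∃ q : ℕ × ℕ → Prop, ComputablePred q ∧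
      ∀ n, n ∉ greedyIndices (A.elem 0) ↔ ∃ t, q (n, t) := by
  obtain ⟨dec, hdec, hdecs⟩ : ∃ dec : ℕ → ℕ × CoeffWord, Computable dec ∧ Function.Surjective dec :=
    ⟨fun t => (Encodable.decode t).getD (0, ([], [])),
      Computable.option_getD Computable.decode (Computable.const _),
      fun x => ⟨Encodable.encode x, by
        simp only [Encodable.encodek, Option.getD_some]⟩⟩
  -- Padding with zeros keeps the span and admits all coefficient vectors.
  let u : ℕ → ℕ → A.dom 0 := fun n j => if j < n then A.elem 0 j else 0
  have hz {β : Type} [Primcodable β] : Computable fun _ : β => 0 := Computable.const 0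
  have hu : Computable fun p : ℕ × ℕ => (u p.1 p.2 : ℕ) := by
    refine (Computable.ite_pred (p := fun p : ℕ × ℕ => p.2 < p.1)
      (Primrec.nat_lt.comp Primrec.snd Primrec.fst).computablePred
      (hA.computable_elem hz Computable.snd) (hA.computable_zero hz)).of_eq fun p => ?_
    simp only [u]
    split_ifs <;> rfl
  have hspan : ∀ n, Submodule.span ℤ (A.elem 0 '' Set.Iio n) =
      LinearMap.range (Finsupp.linearCombination ℤ (u n)) := by
    intro n
    rw [Finsupp.range_linearCombination]
    apply le_antisymm <;> rw [Submodule.span_le]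
    · rintro _ ⟨j, hj, rfl⟩
      exact Submodule.subset_span ⟨j, if_pos hj⟩
    · rintro _ ⟨j, rfl⟩
      by_cases hj : j < n
      · simp only [u, if_pos hj]
        exact Submodule.subset_span ⟨j, hj, rfl⟩
      · simp only [u, if_neg hj]
        exact zero_mem _
  clear_value u
  refine ⟨fun p => ((dec p.2).1 + 1) • A.elem 0 p.1 =
    Finsupp.linearCombination ℤ (u p.1) (dec p.2).2.vec, ?_, fun n => ?_⟩
  · have hm : Computable fun p : ℕ × ℕ => (dec p.2).1 + 1 :=
      Computable.succ.comp (Computable.fst.comp (hdec.comp Computable.snd))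
    have hl : Computable fun p : ℕ × ℕ =>
        ((((dec p.2).1 + 1) • A.elem 0 p.1 : A.dom 0) : ℕ) :=
      hA.computable_nsmul (i := fun _ => 0) hz (hA.computable_elem hz Computable.fst) hm
    have hu' : Computable fun r : (ℕ × ℕ) × ℕ => (u r.1.1 r.2 : ℕ) :=
      hu.comp ((Computable.fst.comp Computable.fst).pair Computable.snd)
    have hw : Computable fun p : ℕ × ℕ => (dec p.2).2 :=
      Computable.snd.comp (hdec.comp Computable.snd)
    have hr : Computable fun p : ℕ × ℕ =>
        ((Finsupp.linearCombination ℤ (u p.1) (dec p.2).2.vec : A.dom 0) : ℕ) :=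
      hA.computable_linearCombination (i := fun _ => 0) hz (u := fun p : ℕ × ℕ => u p.1) hu' hw
    refine (ComputablePred.eq hl hr).of_eq fun p => ?_
    rw [← Subtype.ext_iff]
  · rw [greedyIndices, Set.mem_ofPred_eq, not_not, mem_radicalSpan, hspan]
    constructor
    · rintro ⟨m, hm, z, hz⟩
      -- Witnesses use positive multipliers, so the sign of `m` moves into the coefficients.
      obtain ⟨w, hw⟩ := CoeffWord.vec_surjective (m.sign • z)
      obtain ⟨t, ht⟩ := hdecs (m.natAbs - 1, w)
      refine ⟨t, ?_⟩
      have h1 : m.natAbs - 1 + 1 = m.natAbs := by have := Int.natAbs_pos.2 hm; omega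
      simp only [ht, h1, hw, map_smul]
      rw [hz, smul_smul, Int.sign_mul_self_eq_natAbs, natCast_zsmul]
    · rintro ⟨t, ht⟩
      exact ⟨((dec t).1 + 1 : ℕ), by omega, _, by rw [natCast_zsmul]; exact ht.symm⟩

/-- When the rank is infinite, some independent generating sequence (up to torsion) is the
sequence of sums of a computable array of increments, each row of which is eventually zero. -/
theorem IsComputable.exists_increments {A : InverseSequence} (hA : A.IsComputable)
    (hinf : (greedyIndices (A.elem 0)).Infinite) :
    ∃ (d : ℕ → ℕ → A.dom 0) (S : ℕ → ℕ), (Computable fun p : ℕ × ℕ => (d p.1 p.2 : ℕ)) ∧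
      (∀ k t, S k ≤ t → d t k = 0) ∧ LinearIndependent ℤ (A.tailAt d S 0 0) ∧
      ∀ x, x ∈ radicalSpan (Set.range (A.tailAt d S 0 0)) := by
  classical
  obtain ⟨q, hq, hqs⟩ := hA.exists_dependence_witness
  set C : ℕ → Prop := fun n => n ∈ greedyIndices (A.elem 0) with hC
  -- The indices not refuted before stage `s`: decidable sets decreasing to `C`.
  let Cs : ℕ → ℕ → Prop := fun s n => ∀ t < s, ¬ q (n, t)
  have hCinf : (Set.ofPred C).Infinite := hinf
  have hCCs : ∀ s n, C n → Cs s n := fun s n hn t _ hqt => (hqs n).2 ⟨t, hqt⟩ hn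
  have hCsinf : ∀ s, {n | Cs s n}.Infinite := fun s => hinf.mono fun n hn => hCCs s n hn
  have hCsc : ComputablePred fun p : ℕ × ℕ => Cs p.1 p.2 :=
    ComputablePred.forall_lt (p := fun r : (ℕ × ℕ) × ℕ => ¬ q (r.1.2, r.2))
      (hq.comp ((Computable.snd.comp Computable.fst).pair Computable.snd)).not Computable.fst
  let c : ℕ → ℕ → ℕ := fun s k => Nat.nth (Cs s) k
  let cl : ℕ → ℕ := Nat.nth C
  have hcc : Computable fun p : ℕ × ℕ => c p.1 p.2 :=
    Computable.nth (α := ℕ × ℕ) (p := fun r => Cs r.1.1 r.2)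
      (hCsc.comp ((Computable.fst.comp Computable.fst).pair Computable.snd))
      (fun a => hCsinf a.1) Computable.snd
  have hcle : ∀ s k, c s k ≤ cl k := fun s k => Nat.lt_succ_iff.1 <| Nat.nth_lt_of_lt_count <| by
    refine Nat.lt_of_lt_of_le ?_ (Nat.count_mono_left (p := C) fun n _ => hCCs s n)
    rw [Nat.succ_eq_add_one, Nat.count_nth_succ_of_infinite hCinf]
    exact Nat.lt_succ_self k
  have hlim : ∀ k, ∃ T, ∀ t, T ≤ t → c t k = cl k := by
    intro k
    have hw : ∀ n, ∃ t, ¬ C n → q (n, t) := fun n => by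
      by_cases hn : C n
      · exact ⟨0, fun h => absurd hn h⟩
      · obtain ⟨t, ht⟩ := (hqs n).1 hn
        exact ⟨t, fun _ => ht⟩
    choose w hw using hw
    -- By this stage every index below `cl k` outside `C` has been refuted.
    refine ⟨(Finset.range (cl k)).sup w + 1, fun t ht => ?_⟩
    have hCst : ∀ n < cl k, Cs t n → C n := fun n hn h => by
      by_contra hn'
      refine h (w n) ?_ (hw n hn')
      have := Finset.le_sup (f := w) (Finset.mem_range.2 hn)
      omega
    have hcount : Nat.count (Cs t) (cl k) = k :=
      (le_antisymm (Nat.count_mono_left hCst) (Nat.count_mono_left fun n _ => hCCs t n)).trans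
        (Nat.count_nth_of_infinite hCinf k)
    have := Nat.nth_count (p := Cs t) (hCCs t _ (Nat.nth_mem_of_infinite hCinf k))
    change Nat.nth (Cs t) (Nat.count (Cs t) (cl k)) = cl k at this
    rwa [hcount] at this
  choose T hT using hlim
  let d : ℕ → ℕ → A.dom 0 := fun t k =>
    if t = 0 ∨ c t k ≠ c (t - 1) k then A.elem 0 (c t k) else 0
  have hd : Computable fun p : ℕ × ℕ => (d p.1 p.2 : ℕ) := by
    have hz : Computable fun _ : ℕ × ℕ => 0 := Computable.const 0
    refine (Computable.ite_pred (p := fun p : ℕ × ℕ => p.1 = 0 ∨ ¬ c p.1 p.2 = c (p.1 - 1) p.2)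
      ((ComputablePred.eq Computable.fst hz).or (ComputablePred.eq hcc (hcc.comp
        ((Computable.pred.comp Computable.fst).pair Computable.snd))).not)
      (hA.computable_elem hz hcc) (hA.computable_zero hz)).of_eq fun p => ?_
    simp only [d, ne_eq]
    split_ifs <;> rfl
  -- The guess may still change at `T k` itself; from `T k + 1` on, both `t` and `t - 1` are past
  -- the last change.
  have hS : ∀ k t, T k + 1 ≤ t → d t k = 0 := fun k t ht => by
    refine if_neg ?_
    rw [hT k t (by omega), hT k (t - 1) (by omega)]
    simp only [ne_eq, not_true_eq_false, or_false]
    omega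
  have hf : ∀ k, A.tailAt d (fun k => T k + 1) 0 0 k =
      ∑ t ∈ Finset.range (T k + 1), t.factorial • d t k := fun k => by
    simp [tailAt, factorialTail, lift]
  have hg : ∀ k, ∃ N : ℤ, N ≠ 0 ∧ A.tailAt d (fun k => T k + 1) 0 0 k - N • A.elem 0 (cl k) ∈
      Submodule.span ℤ (A.elem 0 '' Set.Iio (cl k)) := fun k => by
    rw [hf]
    exact exists_leading_term (A.elem 0) (fun t => c t k) (cl k) (fun t => hcle t k)
      (hT k _ le_rfl) (Nat.lt_succ_self _)
  have hmono : StrictMono cl := Nat.nth_strictMono hCinf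
  have hran : Set.range cl = greedyIndices (A.elem 0) := Nat.range_nth_of_infinite hCinf
  exact ⟨d, fun k => T k + 1, hd, hS, linearIndependent_triangular hmono hran hg,
    mem_radicalSpan_triangular hmono hran hg (A.elem_surjective 0)⟩

theorem exists_presentation_of_finite {G : Type*} [AddCommGroup G] [TopologicalSpace G]
    {A : InverseSequence} (hA : A.IsComputableTDLCPresentation G)
    (hfin : (greedyIndices (A.elem 0)).Finite) :
    ∃ C : ∀ i, Set (A.dom i), A.IsComputableMaximalLinIndep C := by
  let g : ∀ i, greedyIndices (A.elem 0) → A.dom i := fun i n => A.lift (A.elem 0 n) i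
  have hg : ∀ i, A.proj i ∘ g i = fun n : greedyIndices (A.elem 0) => A.elem 0 n := fun i => by
    funext n
    simp [g]
  refine ⟨fun i => Set.range (g i), fun i => ?_, ?_⟩
  · obtain ⟨h1, h2⟩ := linearIndependent_radicalSpan_of_hom (A.proj i)
      (hA.kernels.exists_smul_eq_zero i) (g := g i) (by rw [hg]; exact linearIndependent_greedy _)
      (by rw [hg]; exact mem_radicalSpan_greedy (A.elem_surjective 0))
    exact maximal_linearIndepOn_range h1 h2
  -- The finite set of indices is built into the algorithm; only the lifting is uniform in the
  -- level.
  · have key : ∀ s : Set ℕ, s.Finite → ComputablePred fun p : ℕ × ℕ =>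
        ∃ n ∈ s, (A.lift (A.elem 0 n) p.1 : ℕ) = p.2 := by
      intro s hs
      induction s, hs using Set.Finite.induction_on with
      | empty => exact (ComputablePred.eq (α := ℕ × ℕ) (Computable.const 0)
          (Computable.const 1)).of_eq fun p => by simp
      | @insert n s _ _ ih =>
        refine (((ComputablePred.eq (hA.computable.computable_lift Computable.fst
          (Computable.const (A.elem 0 n : ℕ))) Computable.snd).or ih)).of_eq fun p => ?_
        simp
    refine (key _ hfin).of_eq fun p => ?_
    simp only [Set.mem_image, Set.mem_range, g]
    constructor
    · rintro ⟨n, hn, h⟩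
      exact ⟨_, ⟨⟨n, hn⟩, rfl⟩, h⟩
    · rintro ⟨_, ⟨⟨n, hn⟩, rfl⟩, h⟩
      exact ⟨n, hn, h⟩

theorem exists_presentation_of_infinite {G : Type*} [AddCommGroup G] [TopologicalSpace G]
    {A : InverseSequence} (hA : A.IsComputableTDLCPresentation G)
    (hinf : (greedyIndices (A.elem 0)).Infinite) :
    ∃ B : InverseSequence, B.IsComputableTDLCPresentation G ∧
      (∃ C : ∀ i, Set (B.dom i), B.IsComputableMaximalLinIndep C) ∧ ∀ i, B.dom i = Set.univ := by
  obtain ⟨d, S, hd, hS, hli, hgen⟩ := hA.computable.exists_increments hinf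
  have hinfA : ∀ i, Infinite (A.dom i) := fun i =>
    have : Infinite (A.dom 0) := Infinite.of_injective _ hli.injective
    Infinite.of_surjective _ (A.proj_surjective i)
  let ν := stageNumbering hA.computable hd hS hli hgen
  obtain ⟨β, c, hc, hβ⟩ := ν.exists_bijective hinfA
  let e := A.transportEquiv β
  let g : ∀ i, ℕ → (A.transport β).dom i := fun i k => (e i).symm (A.tailAt d S i 0 k)
  let p : ∀ i, (A.transport β).dom i →+ A.dom 0 := fun i => (A.proj i).comp (e i).toAddMonoidHom
  have hg : ∀ i, p i ∘ g i = A.tailAt d S 0 0 := fun i => by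
    funext k
    simp [p, g, proj_tailAt]
  refine ⟨A.transport β, ⟨ν.isComputable_transport hc hβ,
    ν.hasComputableKernels_transport hc hβ hA.computable hA.kernels, ?_⟩,
    ⟨fun i => Set.range (g i), fun i => ?_, ?_⟩, fun _ => rfl⟩
  · obtain ⟨φ⟩ := hA.iso
    exact ⟨φ.trans (invLimitCongr e (A.transportEquiv_map β))⟩
  · have hker : ∀ x, p i x = 0 → ∃ m : ℤ, m ≠ 0 ∧ m • x = 0 := fun x hx => by
      obtain ⟨m, hm, h⟩ := hA.kernels.exists_smul_eq_zero i (e i x) hx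
      exact ⟨m, hm, (e i).injective (by rw [map_zsmul, h, map_zero])⟩
    obtain ⟨h1, h2⟩ := linearIndependent_radicalSpan_of_hom (p i) hker (g := g i)
      (by rw [hg]; exact hli) (by rw [hg]; exact hgen)
    exact maximal_linearIndepOn_range h1 h2
  · refine ((computablePred_val_mem_range hA.computable hd hS hli hgen).comp
      (Computable.fst.pair hc)).of_eq fun q => ?_
    have hq : StageCode.val A d S q.1 (c q) = e q.1 ⟨q.2, Set.mem_univ _⟩ := hβ q.1 q.2
    rw [hq]
    constructor
    · rintro ⟨k, hk⟩
      exact ⟨_, ⟨k, rfl⟩, by simp only [g, hk, AddEquiv.symm_apply_apply]⟩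
    · rintro ⟨_, ⟨k, rfl⟩, hk⟩
      refine ⟨k, ?_⟩
      rw [← AddEquiv.symm_apply_eq]
      exact Subtype.ext hk

end InverseSequence

theorem proposition5p1 (G : Type*) [AddCommGroup G] [TopologicalSpace G] [IsTopologicalAddGroup G]
    (A : InverseSequence) (hA : A.IsComputableTDLCPresentation G) :
    ∃ B : InverseSequence, B.IsComputableTDLCPresentation G ∧
      (∃ C : ∀ i, Set (B.dom i), B.IsComputableMaximalLinIndep C) ∧
      ((∀ i, A.dom i = Set.univ) → ∀ i, B.dom i = Set.univ) := by
  -- The case distinction need not be effective. Finite rank keeps `A` with its domains; infinite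
  -- rank always produces domains `ℕ`.
  by_cases h : (greedyIndices (A.elem 0)).Finite
  · exact ⟨A, hA, InverseSequence.exists_presentation_of_finite hA h, fun h => h⟩
  · obtain ⟨B, hB, hC, hdom⟩ := InverseSequence.exists_presentation_of_infinite hA h
    exact ⟨B, hB, hC, fun _ => hdom⟩
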